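/- Let $2829\le K\le L\le M$ and $q\ge 2$ be integers, $\mathbb{T}_n=\mathbb{Z}/n\mathbb{Z}$, $\Lambda=\mathbb{T}_K\times\mathbb{T}_L\times\mathbb{T}_M$ with its nearest-neighbour (periodic) graph structure, $S=\{1,\dots,q\}$, $\mathcal{X}=S^\Lambda$, and let $H(\sigma)$ be the number of unordered pairs $\{x,y\}$ of neighbouring sites with $\sigma(x)\ne\sigma(y)$. Write $\mathbf{s}_a\equiv a$ for the monochromatic configurations (ground states), $\mathcal{S}(A)=\{\mathbf{s}_a:a\in A\}$, and $\mathcal{S}=\mathcal{S}(S)$. A path is a finite sequence $(\omega_t)_{t=0}^T$, $T\ge0$, in which consecutive configurations differ at exactly one site; it connects two configurations (or two sets) if its end points are these configurations (or lie in these sets), in either order. Let $\Phi(\sigma,\zeta)=\min_{(\omega_t)}\max_t H(\omega_t)$ over all paths connecting $\sigma$ and $\zeta$, and put $$\Gamma=2KL+2K+2,\qquad \mathfrak{m}_K=\lfloor K^{2/3}\rfloor .$$ Gateway configurations in two dimensions. On $\mathbb{T}_K\times\mathbb{T}_L$ let $\mathcal{X}^{2D}$, $H^{2D}$, $\mathbf{s}_a^{2D}$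 and paths be defined in the same way, and let $a\ne b$ be spins. Let $\mathcal{R}_v^{a,b}$ be the set of configurations with spin $b$ on a strip $\mathbb{T}_K\times\{\ell,\dots,\ell+v-1\}$, $\ell\in\mathbb{T}_L$, and spin $a$ elsewhere; let $\mathcal{Q}_v^{a,b}$ be the set of configurations with spin $b$ exactly on the union of such a strip and a bar $\{k,\dots,k+h-1\}\times\{\ell'\}$, where $k\in\mathbb{T}_K$, $1\le h\le K-1$ and $\ell'\in\{\ell+v,\ell-1\}$, and spin $a$ elsewhere. If $K=L$, both families also contain the transposes of these configurations. Put $\mathcal{B}_\Gamma^{a,b}=\bigcup_{v=2}^{L-3}\mathcal{Q}_v^{a,b}$, $\mathcal{B}_\Gamma=\bigcup_{a\neq b}\mathcal{B}_\Gamma^{a,b}$ and $\mathcal{B}^{a,b}=\bigcup_{v=2}^{L-2}\mathcal{R}_v^{a,b}\cup\mathcal{B}_\Gamma^{a,b}$. Let $\mathcal{Z}^{a,b}$ be the set of end points $\omega_T$ of paths $(\omega_t)_{t=0}^T$ in $\mathcal{X}^{2D}\setminus\mathcal{B}_\Gamma$ with $T\ge1$, $\omega_0\in\mathcal{R}_2^{a,b}$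 and $H^{2D}(\omega_t)=2K+2$ for $1\le t\le T$. Finally, $\mathcal{G}^{a,b,2D}=\mathcal{Z}^{a,b}\cup\mathcal{B}^{a,b}\cup\mathcal{Z}^{b,a}$. Gateway configurations in three dimensions. For connected subsets $P\subseteq Q$ of the cycle $\mathbb{T}_M$ ($\emptyset$ and $\mathbb{T}_M$ included) with $|Q|=|P|+1$, let $\widetilde{\mathcal{G}}_{P,Q}^{a,b}$ be the set of $\sigma\in\mathcal{X}$ whose restriction $\sigma^{(m)}$ to the floor $\mathbb{T}_K\times\mathbb{T}_L\times\{m\}$ is $\mathbf{s}_b^{2D}$ for $m\in P$, is $\mathbf{s}_a^{2D}$ for $m\notin Q$, and lies in $\mathcal{G}^{a,b,2D}$ for $m\in Q\setminus P$. Let $\Upsilon$ map a set of configurations to the set of all their images under the permutations of the three coordinates that preserve the side lengths $(K,L,M)$. Let $\mathcal{G}^{a,b}$ be the union of $\Upsilon(\widetilde{\mathcal{G}}_{P,Q}^{a,b})$ over all such $P,Q$ with $\mathfrak{m}_K-1\le|P|\le M-\mathfrak{m}_K$, and $\mathcal{G}^{A,B}=\bigcup_{a\in A}\bigcup_{b\in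 B}\mathcal{G}^{a,b}$. **Proposition.** 1. For all distinct $\mathbf{s},\mathbf{s}'\in\mathcal{S}$, $\Phi(\mathbf{s},\mathbf{s}')\ge\Gamma$; that is, every path connecting them reaches energy at least $\Gamma$. 2. Let $(A,B)$ be a partition of $S$ into two non-empty sets, and let $(\omega_t)_{t=0}^T$ be a path connecting $\mathcal{S}(A)$ and $\mathcal{S}(B)$. If $\omega_t\notin\mathcal{G}^{A,B}$ for all $t$, then $H(\omega_t)\ge\Gamma+1$ for some $t\in\{0,\dots,T\}$. Consequently, if $H(\omega_t)\le\Gamma$ for all $t$, then $\omega_t\in\mathcal{G}^{A,B}$ for some $t$. -/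

import Mathlib

namespace Potts3D

/-! ### Spin configurations, energy and paths on a general finite graph -/

section General

variable {V S : Type*}

/-- The Potts Hamiltonian without external field: the number of edges (unordered pairs of
neighbouring sites) whose two endpoints carry different spins. -/
noncomputable def energy (G : SimpleGraph V) (σ : V → S) : ℕ :=
  Set.ncard {e : Sym2 V | e ∈ G.edgeSet ∧ ¬ (e.map σ).IsDiag}

/-- `σ ∼ ζ`: `ζ` differs from `σ` and is obtained by updating the spin at one site. -/
def Step [DecidableEq V] (σ ζ : V → S) : Prop :=
  ∃ (x : V) (a : S), ζ = Function.update σ x a ∧ ζ ≠ σ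

/-- `ω 0, …, ω T` is a path of configurations. -/
def IsPath [DecidableEq V] (ω : ℕ → V → S) (T : ℕ) : Prop :=
  ∀ t, t < T → Step (ω t) (ω (t + 1))

/-- The path `ω 0, …, ω T` connects the sets `P` and `Q` (in either direction). -/
def Connects (ω : ℕ → V → S) (T : ℕ) (P Q : Set (V → S)) : Prop :=
  (ω 0 ∈ P ∧ ω T ∈ Q) ∨ (ω 0 ∈ Q ∧ ω T ∈ P)

/-- The communication height `Φ(σ, ζ)`: the minimum, over all paths connecting `σ` and `ζ`, of the
maximal energy along the path. (Any two configurations are connected by a path, so the infimum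
of this set of natural numbers is attained.) -/
noncomputable def commHeight [DecidableEq V] (G : SimpleGraph V) (σ ζ : V → S) : ℕ :=
  sInf {E : ℕ | ∃ (ω : ℕ → V → S) (T : ℕ), IsPath ω T ∧ Connects ω T {σ} {ζ} ∧
    E = (Finset.range (T + 1)).sup (fun t => energy G (ω t))}

/-- The monochromatic configuration `𝐬_a`. -/
def mono (V : Type*) {S : Type*} (a : S) : V → S := fun _ => a

/-- The set `𝒮(A) = {𝐬_a : a ∈ A}`. -/
def groundStates (V : Type*) {S : Type*} (A : Set S) : Set (V → S) :=
  {σ | ∃ a ∈ A, σ = mono V a}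

open Classical in
/-- The configuration with spin `b` on `D` and spin `a` off `D`. -/
noncomputable def twoSpin (a b : S) (D : Set V) : V → S := fun x => if x ∈ D then b else a

/-- `(A, B)` is a proper partition of the spin set. -/
def IsProperPartition (A B : Set S) : Prop :=
  A.Nonempty ∧ B.Nonempty ∧ A ∪ B = Set.univ ∧ A ∩ B = ∅

end General

/-! ### Discrete tori -/

/-- The discrete one-dimensional torus `𝕋_n = ℤ/nℤ`, with `x` adjacent to `x ± 1`. -/
def torus1 (n : ℕ) : SimpleGraph (ZMod n) := SimpleGraph.circulantGraph {1}

/-- The sites of `𝕋_K × 𝕋_L`. -/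
abbrev Site2 (K L : ℕ) := ZMod K × ZMod L

/-- The sites of `𝕋_K × 𝕋_L × 𝕋_M`. -/
abbrev Site3 (K L M : ℕ) := Site2 K L × ZMod M

/-- The nearest-neighbour graph on `𝕋_K × 𝕋_L`. -/
def torus2 (K L : ℕ) : SimpleGraph (Site2 K L) := (torus1 K).boxProd (torus1 L)

/-- The nearest-neighbour graph on `𝕋_K × 𝕋_L × 𝕋_M`. -/
def torus3 (K L M : ℕ) : SimpleGraph (Site3 K L M) := (torus2 K L).boxProd (torus1 M)

/-- The collection `𝔖_N` of connected subsets of `𝕋_N` (including `∅` and `𝕋_N`). -/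
def connSets (N : ℕ) : Set (Set (ZMod N)) := {P | ((torus1 N).induce P).Preconnected}

/-- `P ≺ Q`: `P ⊆ Q` and `|Q| = |P| + 1`. -/
def Prec {N : ℕ} (P Q : Set (ZMod N)) : Prop := P ⊆ Q ∧ Q.ncard = P.ncard + 1

/-- The arc `{ℓ, ℓ + 1, …, ℓ + v - 1}` in `𝕋_N`. -/
def arc {N : ℕ} (l : ZMod N) (v : ℕ) : Set (ZMod N) := {x | ∃ n : ℕ, n < v ∧ x = l + (n : ZMod N)}

/-! ### Gateway configurations of the two-dimensional model (for `K ≤ L`) -/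

section TwoD

variable {S : Type*}

/-- The two-dimensional energy barrier `2K + 2`. -/
def Gamma2 (K : ℕ) : ℕ := 2 * K + 2

/-- The transpose operator, available when `K = L`. -/
def transpose {K L : ℕ} (h : K = L) (η : Site2 K L → S) : Site2 K L → S :=
  fun x => η (ZMod.ringEquivCongr h.symm x.2, ZMod.ringEquivCongr h x.1)

/-- A set of configurations, together with the transposed configurations if `K = L`. -/
def withTranspose {K L : ℕ} (𝒜 : Set (Site2 K L → S)) : Set (Site2 K L → S) :=
  {η | η ∈ 𝒜 ∨ ∃ h : K = L, ∃ ξ ∈ 𝒜, η = transpose h ξ}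

/-- The strip configuration `ξ_{ℓ,v}`: spins `b` on `𝕋_K × {ℓ, …, ℓ + v - 1}`, spins `a`
elsewhere. -/
noncomputable def xi (K L : ℕ) (a b : S) (l : ZMod L) (v : ℕ) : Site2 K L → S :=
  twoSpin a b {x | x.2 ∈ arc l v}

/-- The configuration `ξ^+_{ℓ,v;k,h}`: the strip with a bar of length `h` attached on the
line `ℓ + v`. -/
noncomputable def xiPlus (K L : ℕ) (a b : S) (l : ZMod L) (v : ℕ) (k : ZMod K) (h : ℕ) :
    Site2 K L → S :=
  twoSpin a b {x | x.2 ∈ arc l v ∨ (x.1 ∈ arc k h ∧ x.2 = l + (v : ZMod L))}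

/-- The configuration `ξ^-_{ℓ,v;k,h}`: the strip with a bar of length `h` attached on the
line `ℓ - 1`. -/
noncomputable def xiMinus (K L : ℕ) (a b : S) (l : ZMod L) (v : ℕ) (k : ZMod K) (h : ℕ) :
    Site2 K L → S :=
  twoSpin a b {x | x.2 ∈ arc l v ∨ (x.1 ∈ arc k h ∧ x.2 = l - 1)}

/-- The regular configurations `ℛ_v^{a,b}` of the two-dimensional model. -/
def regular2 (K L : ℕ) (a b : S) (v : ℕ) : Set (Site2 K L → S) :=
  withTranspose {η | ∃ l : ZMod L, η = xi K L a b l v}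

/-- The sets `𝒬_v^{a,b}` of strips with an incomplete additional line. -/
def incomplete2 (K L : ℕ) (a b : S) (v : ℕ) : Set (Site2 K L → S) :=
  withTranspose {η | ∃ (l : ZMod L) (k : ZMod K) (h : ℕ), 1 ≤ h ∧ h + 1 ≤ K ∧
    (η = xiPlus K L a b l v k h ∨ η = xiMinus K L a b l v k h)}

/-- `ℬ_Γ^{a,b} = ⋃_{2 ≤ v ≤ L - 3} 𝒬_v^{a,b}`. -/
def bulkGamma2 (K L : ℕ) (a b : S) : Set (Site2 K L → S) :=
  {η | ∃ v : ℕ, 2 ≤ v ∧ v + 3 ≤ L ∧ η ∈ incomplete2 K L a b v}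

/-- The bulk typical configurations
`ℬ^{a,b} = ⋃_{2 ≤ v ≤ L - 2} ℛ_v^{a,b} ∪ ⋃_{2 ≤ v ≤ L - 3} 𝒬_v^{a,b}`. -/
def bulk2 (K L : ℕ) (a b : S) : Set (Site2 K L → S) :=
  {η | ∃ v : ℕ, 2 ≤ v ∧ v + 2 ≤ L ∧ η ∈ regular2 K L a b v} ∪ bulkGamma2 K L a b

/-- `ℬ_Γ`, the union of `ℬ_Γ^{a,b}` over distinct spins `a, b`. -/
def bulkGammaAll2 (K L : ℕ) (S : Type*) : Set (Site2 K L → S) :=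
  {η | ∃ a b : S, a ≠ b ∧ η ∈ bulkGamma2 K L a b}

/-- The set `𝒵^{a,b}`: configurations reached from `ℛ_2^{a,b}` by a path of length at least `1`
that avoids `ℬ_Γ` and has energy exactly `2K + 2` after its starting point. -/
def edgeSaddle2 (K L : ℕ) (a b : S) : Set (Site2 K L → S) :=
  {η | ∃ (ω : ℕ → Site2 K L → S) (T : ℕ), 1 ≤ T ∧ IsPath ω T ∧
    (∀ t, t ≤ T → ω t ∉ bulkGammaAll2 K L S) ∧
    ω 0 ∈ regular2 K L a b 2 ∧ ω T = η ∧
    ∀ t, 1 ≤ t → t ≤ T → energy (torus2 K L) (ω t) = Gamma2 K}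

/-- The two-dimensional gateway configurations `𝒢^{a,b} = 𝒵^{a,b} ∪ ℬ^{a,b} ∪ 𝒵^{b,a}`. -/
def gateway2 (K L : ℕ) (a b : S) : Set (Site2 K L → S) :=
  edgeSaddle2 K L a b ∪ bulk2 K L a b ∪ edgeSaddle2 K L b a

end TwoD

/-! ### Gateway configurations of the three-dimensional model (for `K ≤ L ≤ M`) -/

section ThreeD

variable {S : Type*} {K L M : ℕ}

/-- The three-dimensional energy barrier for periodic boundary conditions, `2KL + 2K + 2`. -/
def Gamma (K L : ℕ) : ℕ := 2 * K * L + 2 * K + 2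

/-- The threshold `𝔪_K = ⌊K^{2/3}⌋`. -/
noncomputable def mK (K : ℕ) : ℕ := ⌊(K : ℝ) ^ ((2 : ℝ) / 3)⌋₊

/-- The configuration `σ^{(m)}` on the `m`-th floor. -/
def floorConf (σ : Site3 K L M → S) (m : ZMod M) : Site2 K L → S := fun x => σ (x, m)

/-- Switching the first and second coordinates, when `K = L`. -/
def theta12 (h : K = L) (σ : Site3 K L M → S) : Site3 K L M → S :=
  fun x => σ ((ZMod.ringEquivCongr h.symm x.1.2, ZMod.ringEquivCongr h x.1.1), x.2)

/-- Switching the second and third coordinates, when `L = M`. -/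
def theta23 (h : L = M) (σ : Site3 K L M → S) : Site3 K L M → S :=
  fun x => σ ((x.1.1, ZMod.ringEquivCongr h.symm x.2), ZMod.ringEquivCongr h x.1.2)

/-- Switching the first and third coordinates, when `K = M`. -/
def theta13 (h : K = M) (σ : Site3 K L M → S) : Site3 K L M → S :=
  fun x => σ ((ZMod.ringEquivCongr h.symm x.2, x.1.2), ZMod.ringEquivCongr h x.1.1)

/-- `Υ(𝒜)`: all configurations obtained from those in `𝒜` by the permutations of the coordinates
that preserve the side lengths `K ≤ L ≤ M` of the box. -/
def upsilon (𝒜 : Set (Site3 K L M → S)) : Set (Site3 K L M → S) :=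
  {σ | σ ∈ 𝒜 ∨
    (∃ h : K = L, ∃ τ ∈ 𝒜, σ = theta12 h τ) ∨
    (∃ h : L = M, ∃ τ ∈ 𝒜, σ = theta23 h τ) ∨
    (∃ (h : K = L) (h' : L = M), ∃ τ ∈ 𝒜,
      σ = theta13 (h.trans h') τ ∨ σ = theta12 h (theta23 h' τ) ∨ σ = theta23 h' (theta12 h τ))}

/-- The set `𝒢̃_{P,Q}^{a,b}`: floors in `P` are monochromatic of spin `b`, floors outside `Q` are
monochromatic of spin `a`, and the floor in `Q \ P` is a two-dimensional gateway configuration. -/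
def preGateway (a b : S) (P Q : Set (ZMod M)) : Set (Site3 K L M → S) :=
  {σ | (∀ m ∈ P, floorConf σ m = mono (Site2 K L) b) ∧
    (∀ m, m ∉ Q → floorConf σ m = mono (Site2 K L) a) ∧
    (∀ m ∈ Q \ P, floorConf σ m ∈ gateway2 K L a b)}

/-- The set `𝒢_i^{a,b}`, the union of `Υ(𝒢̃_{P,Q}^{a,b})` over `P ≺ Q` in `𝔖_M` with `|P| = i`. -/
def gatewayLevel (K L M : ℕ) (a b : S) (i : ℕ) : Set (Site3 K L M → S) :=
  {σ | ∃ P ∈ connSets M, ∃ Q ∈ connSets M, P.ncard = i ∧ Prec P Q ∧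
    σ ∈ upsilon (preGateway (K := K) (L := L) a b P Q)}

/-- The gateway configurations `𝒢^{a,b}`, the union of `𝒢_i^{a,b}` over
`𝔪_K - 1 ≤ i ≤ M - 𝔪_K`. -/
def gateway (K L M : ℕ) (a b : S) : Set (Site3 K L M → S) :=
  {σ | ∃ i : ℕ, mK K ≤ i + 1 ∧ i + mK K ≤ M ∧ σ ∈ gatewayLevel K L M a b i}

/-- `𝒢^{A,B} = ⋃_{a ∈ A} ⋃_{b ∈ B} 𝒢^{a,b}`. -/
def gatewayAB (K L M : ℕ) (A B : Set S) : Set (Site3 K L M → S) :=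
  {σ | ∃ a ∈ A, ∃ b ∈ B, σ ∈ gateway K L M a b}

end ThreeD

end Potts3D

/-! Both statements follow from one well-chosen volume. Along a path from `groundStates A` to
`groundStates B` the number of spins in `B` changes by at most one per step, so it takes the value N
= ⌊M/2⌋KL + r, where r is about KL/2 and divisible neither by K nor by L (`exists_volume`). It
suffices that a configuration of volume N has energy at least Γ, and is a gateway configuration if
the energy is at most Γ (`gateway_of_cubeCount`). Only bulk floors, strips with a bar, and the level
⌊M/2⌋ are needed for this.

The energy is a sum of value changes along the lines of the torus, and a non-constant cyclic line
costs at least 2. In each of the three directions, split it into floor energies and pillars. A floor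
of energy E below twice its shorter side has a constant row and a constant column; all lines through
deviating sites then cross these, so at most E²/16 sites deviate from the common value
(`card_ne_le_of_cross`). Such light floors are nearly empty or nearly full of `B`. Since N is close
to half of all sites, `floors_cases` leaves two possibilities: all floors are heavy, or a single
floor is heavy, the others are constant and the pillars cost at least 2KL.

If all floors are heavy in all three directions, the energy is at least 3KL > Γ (`not_all_heavy`).
Otherwise the single heavy floor has volume r, and the planar problem `plane_gateway` gives it
energy at least 2K + 2, with equality only for strips with a bar. The pillars then leave no room
except for two arcs of monochromatic floors around it (`stack_cases`, `stack_gateway`). -/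

namespace Potts3D

/-! ### Value changes along a cycle, and arcs -/

section CyclicChanges

open Finset
open scoped Classical

variable {S : Type*}

/-- The number of places where a cyclic sequence changes its value. -/
noncomputable def changes {n : ℕ} [NeZero n] (f : ZMod n → S) : ℕ :=
  #{i : ZMod n | f i ≠ f (i + 1)}

theorem exists_add_natCast {n : ℕ} [NeZero n] (m i : ZMod n) :
    ∃ j : ℕ, j < n ∧ i = m + (j : ZMod n) :=
  ⟨(i - m).val, ZMod.val_lt _, by rw [ZMod.natCast_zmod_val]; ring⟩

theorem natCast_ne_zero_of_lt {n j : ℕ} (h0 : 0 < j) (h : j < n) : (j : ZMod n) ≠ 0 := by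
  rw [Ne, ZMod.natCast_eq_zero_iff]
  exact Nat.not_dvd_of_pos_of_lt h0 h

theorem natCast_inj_of_lt {n i j : ℕ} (hi : i < n) (hj : j < n)
    (h : (i : ZMod n) = (j : ZMod n)) : i = j := by
  rw [ZMod.natCast_eq_natCast_iff'] at h
  rwa [Nat.mod_eq_of_lt hi, Nat.mod_eq_of_lt hj] at h

/-- The cycle cut open at the edge from `k` to `k + 1` is still connected. -/
theorem const_of_no_change_off {n : ℕ} [NeZero n] {f : ZMod n → S} (k : ZMod n)
    (h : ∀ i, i ≠ k → f i = f (i + 1)) (i j : ZMod n) : f i = f j := by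
  have key : ∀ d : ℕ, d < n → f (k + 1 + (d : ZMod n)) = f (k + 1) := by
    intro d
    induction d with
    | zero => simp
    | succ d ih =>
      intro hd
      rw [← ih (by omega)]
      rw [h (k + 1 + (d : ZMod n))]
      · congr 1; push_cast; ring
      · intro h'
        apply natCast_ne_zero_of_lt (Nat.succ_pos d) hd
        push_cast
        linear_combination h'
  obtain ⟨d, hd, rfl⟩ := exists_add_natCast (k + 1) i
  obtain ⟨d', hd', rfl⟩ := exists_add_natCast (k + 1) j
  rw [key d hd, key d' hd']

theorem two_le_changes {n : ℕ} [NeZero n] {f : ZMod n → S} {i j : ZMod n} (h : f i ≠ f j) :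
    2 ≤ changes f := by
  by_contra hlt
  have hle : #{i : ZMod n | f i ≠ f (i + 1)} ≤ 1 := by unfold changes at hlt; omega
  rw [Finset.card_le_one] at hle
  by_cases hex : ∃ k, f k ≠ f (k + 1)
  · obtain ⟨k, hk⟩ := hex
    refine h (const_of_no_change_off k (fun i hi => ?_) i j)
    by_contra hne
    exact hi (hle i (by simpa using hne) k (by simpa using hk))
  · push Not at hex
    exact h (const_of_no_change_off 0 (fun i _ => hex i) i j)

/-- A finite sequence with at most one change is a concatenation of two constant ones. -/
theorem exists_split_of_single_change (s : ℕ → S) (n : ℕ)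
    (h : #{j ∈ range n | s j ≠ s (j + 1)} ≤ 1) :
    ∃ j₀ ≤ n, (∀ j ≤ j₀, s j = s 0) ∧ ∀ j, j₀ < j → j ≤ n → s j = s n := by
  rw [Finset.card_le_one] at h
  have up : ∀ a b : ℕ, a ≤ b → (∀ j, a ≤ j → j < b → s j = s (j + 1)) → s b = s a := by
    intro a b hab
    induction b, hab using Nat.le_induction with
    | base => simp
    | succ b hb ih =>
      intro hs
      rw [← hs b hb (by omega)]
      exact ih (fun j h1 h2 => hs j h1 (by omega))
  by_cases hex : ∃ j < n, s j ≠ s (j + 1)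
  · obtain ⟨k, hk, hne⟩ := hex
    have huniq : ∀ j < n, j ≠ k → s j = s (j + 1) := by
      intro j hj hjk
      by_contra hc
      exact hjk (h j (by simp [hj, hc]) k (by simp [hk, hne]))
    refine ⟨k, hk.le, fun j hj => up 0 j (by omega) (fun i _ hi => huniq i (by omega) (by omega)),
      fun j hj hjn => (up j n hjn (fun i hi hin => huniq i hin (by omega))).symm⟩
  · push Not at hex
    exact ⟨n, le_rfl, fun j hj => up 0 j (by omega) (fun i _ hi => hex i (by omega)),
      fun j hj hjn => by omega⟩

theorem ncard_arc {n : ℕ} (l : ZMod n) {v : ℕ} (hv : v ≤ n) :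
    (arc l v).ncard = v := by
  have : arc l v = (fun j : ℕ => l + (j : ZMod n)) '' (Finset.range v : Set ℕ) := by
    ext x
    simp only [arc, Set.mem_ofPred_eq, Set.mem_image, Finset.coe_range, Set.mem_Iio]
    constructor
    · rintro ⟨j, hj, rfl⟩; exact ⟨j, hj, rfl⟩
    · rintro ⟨j, hj, rfl⟩; exact ⟨j, hj, rfl⟩
  rw [this, Set.InjOn.ncard_image, Set.ncard_coe_finset, Finset.card_range]
  intro i hi j hj hij
  simp only [Finset.coe_range, Set.mem_Iio] at hi hj
  exact natCast_inj_of_lt (by omega) (by omega) (add_left_cancel hij)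

/-- A cyclic sequence with two changes takes each of its two values on an arc. -/
theorem exists_arc_of_changes_le_two {n : ℕ} [NeZero n] {g : ZMod n → S} {a b : S}
    (hab : a ≠ b) (hg : ∀ i, g i = a ∨ g i = b) (ha : ∃ i, g i = a) (hb : ∃ i, g i = b)
    (h2 : changes g ≤ 2) :
    ∃ (k : ZMod n) (h : ℕ), 1 ≤ h ∧ h + 1 ≤ n ∧ ∀ i, g i = b ↔ i ∈ arc k h := by
  obtain ⟨k, hk, hk1⟩ : ∃ k, g k = a ∧ g (k + 1) = b := by
    by_contra hcon
    push Not at hcon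
    obtain ⟨i, hi⟩ := ha
    obtain ⟨j, hj⟩ := hb
    have : ∀ d : ℕ, g (i + (d : ZMod n)) = a := by
      intro d
      induction d with
      | zero => simpa using hi
      | succ d ih =>
        have := hcon _ ih
        rcases hg (i + (d : ZMod n) + 1) with h | h
        · push_cast; rw [← add_assoc]; exact h
        · exact absurd h this
    obtain ⟨d, -, rfl⟩ := exists_add_natCast i j
    exact hab ((this d).symm.trans hj)
  have hn : 0 < n := Nat.pos_of_ne_zero (NeZero.ne n)
  obtain ⟨p, rfl⟩ : ∃ p, n = p + 1 := ⟨n - 1, by omega⟩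
  set s : ℕ → S := fun j => g (k + 1 + (j : ZMod (p + 1))) with hs
  have hlast : k + 1 + (p : ZMod (p + 1)) = k := by
    have : ((p + 1 : ℕ) : ZMod (p + 1)) = 0 := ZMod.natCast_self _
    push_cast at this
    linear_combination this
  have hcard : #{j ∈ range p | s j ≠ s (j + 1)} ≤ 1 := by
    have hk' : k ∈ ({i | g i ≠ g (i + 1)} : Finset (ZMod (p + 1))) := by
      simp [hk, hk1, hab]
    have hlt : #(({i | g i ≠ g (i + 1)} : Finset (ZMod (p + 1))).erase k) ≤ 1 := by
      rw [Finset.card_erase_of_mem hk']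
      unfold changes at h2
      omega
    refine le_trans (Finset.card_le_card_of_injOn (fun j => k + 1 + (j : ZMod (p + 1))) ?_ ?_) hlt
    · intro j hj
      simp only [Finset.coe_filter, Finset.mem_range, Set.mem_ofPred_eq] at hj
      simp only [Finset.coe_erase, Set.mem_sdiff, Finset.coe_filter, Set.mem_ofPred_eq,
        Finset.mem_univ, true_and, Set.mem_singleton_iff]
      refine ⟨?_, fun h' => natCast_ne_zero_of_lt (Nat.succ_pos j)
        (show j + 1 < p + 1 by omega) ?_⟩
      · have := hj.2
        simp only [hs] at this
        push_cast at this
        rwa [← add_assoc] at this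
      · push_cast; linear_combination h'
    · intro i hi j hj hij
      simp only [Finset.coe_filter, Finset.mem_range, Set.mem_ofPred_eq] at hi hj
      exact natCast_inj_of_lt (by omega) (by omega) (add_left_cancel hij)
  obtain ⟨j₀, hj₀, h1, h3⟩ := exists_split_of_single_change s p hcard
  have hs0 : s 0 = b := by simp [hs, hk1]
  have hsp : s p = a := by simp only [hs, hlast]; exact hk
  have hj₀p : j₀ ≠ p := by
    rintro rfl
    exact hab ((hsp.symm.trans (h1 _ le_rfl)).trans hs0)
  refine ⟨k + 1, j₀ + 1, by omega, by omega, fun i => ⟨fun hi => ?_, ?_⟩⟩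
  · obtain ⟨j, hj, rfl⟩ := exists_add_natCast (k + 1) i
    refine ⟨j, ?_, rfl⟩
    by_contra hc
    have := h3 j (by omega) (by omega)
    exact hab ((hsp.symm.trans this.symm).trans hi)
  · rintro ⟨j, hj, rfl⟩
    exact (h1 j (by omega)).trans hs0

end CyclicChanges

end Potts3D

namespace Potts3D

/-! ### Stacks of layers with at most one non-constant layer -/

section Stack

open Finset
open scoped Classical

variable {S : Type*}

/-- The three terms count changes on disjoint sets of edges: those away from `m₀`, the one leaving
`m₀` and the one entering it. -/
theorem changes_ge_of_eq_off {n : ℕ} [NeZero n] (hn : 3 ≤ n) {g c : ZMod n → S} {m₀ : ZMod n}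
    (hg : ∀ m, m ≠ m₀ → g m = c m) :
    #{m : ZMod n | m ≠ m₀ ∧ m + 1 ≠ m₀ ∧ c m ≠ c (m + 1)} +
      (if g m₀ ≠ c (m₀ + 1) then 1 else 0) + (if g m₀ ≠ c (m₀ - 1) then 1 else 0)
      ≤ changes g := by
  have h1 : (1 : ZMod n) ≠ 0 := by
    have := natCast_ne_zero_of_lt (n := n) Nat.one_pos (by omega); simpa using this
  have hp : m₀ + 1 ≠ m₀ := by simpa using h1
  have hm : m₀ - 1 ≠ m₀ := by simpa using h1
  set D : Finset (ZMod n) := {m : ZMod n | m ≠ m₀ ∧ m + 1 ≠ m₀ ∧ c m ≠ c (m + 1)}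
  set U : Finset (ZMod n) := if g m₀ ≠ c (m₀ + 1) then {m₀} else ∅ with hU
  set V : Finset (ZMod n) := if g m₀ ≠ c (m₀ - 1) then {m₀ - 1} else ∅ with hV
  have hUc : #U = if g m₀ ≠ c (m₀ + 1) then 1 else 0 := by
    rw [hU]; split_ifs <;> simp
  have hVc : #V = if g m₀ ≠ c (m₀ - 1) then 1 else 0 := by
    rw [hV]; split_ifs <;> simp
  have hUm : ∀ x ∈ U, x = m₀ ∧ g m₀ ≠ c (m₀ + 1) := by
    intro x hx
    rw [hU] at hx
    split_ifs at hx with h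
    · exact ⟨by simpa using hx, h⟩
    · simp at hx
  have hVm : ∀ x ∈ V, x = m₀ - 1 ∧ g m₀ ≠ c (m₀ - 1) := by
    intro x hx
    rw [hV] at hx
    split_ifs at hx with h
    · exact ⟨by simpa using hx, h⟩
    · simp at hx
  have hDU : Disjoint D U := by
    rw [Finset.disjoint_left]
    intro x hx hx'
    exact (Finset.mem_filter.1 hx).2.1 (hUm x hx').1
  have hDV : Disjoint (D ∪ U) V := by
    rw [Finset.disjoint_left]
    intro x hx hx'
    have hxe := (hVm x hx').1
    rcases Finset.mem_union.1 hx with hx | hx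
    · exact (Finset.mem_filter.1 hx).2.2.1 (by rw [hxe]; ring)
    · exact hm (hxe.symm.trans (hUm x hx).1)
  rw [← hUc, ← hVc, ← Finset.card_union_of_disjoint hDU, ← Finset.card_union_of_disjoint hDV]
  refine Finset.card_le_card fun x hx => ?_
  simp only [Finset.mem_filter, Finset.mem_univ, true_and]
  rcases Finset.mem_union.1 hx with hx | hx
  · rcases Finset.mem_union.1 hx with hx | hx
    · obtain ⟨-, h1, h2, h3⟩ := Finset.mem_filter.1 hx
      rwa [hg _ h1, hg _ h2]
    · obtain ⟨rfl, h⟩ := hUm x hx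
      rwa [hg _ hp]
  · obtain ⟨rfl, h⟩ := hVm x hx
    rw [sub_add_cancel, hg _ hm]
    exact h.symm

/-- A stack of layers over the cycle, all but one of them constant, in which the lines crossing
the layers have at most `2 |P| + e` changes altogether. -/
theorem stack_cases {P : Type*} [Fintype P] {n : ℕ} [NeZero n] (hn : 3 ≤ n)
    {F : P → ZMod n → S} {c : ZMod n → S} {m₀ : ZMod n} {e : ℕ}
    (hF : ∀ p m, m ≠ m₀ → F p m = c m)
    (hsum : ∑ p, changes (F p) ≤ 2 * Fintype.card P + e) :
    (∃ a, #{p | F p m₀ ≠ a} ≤ e) ∨ (∃ a, ∀ m, m ≠ m₀ → c m = a) ∨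
    ∃ a b, a ≠ b ∧ (∀ m, m ≠ m₀ → c m = a ∨ c m = b) ∧ #{p | F p m₀ ≠ a ∧ F p m₀ ≠ b} ≤ e ∧
      (∃ (l : ZMod n) (v : ℕ), v + 2 ≤ n ∧ arc l v = {m | m ≠ m₀ ∧ c m = a} ∧
        (m₀ = l + (v : ZMod n) ∨ m₀ = l - 1)) ∧
      (∃ (l : ZMod n) (v : ℕ), v + 2 ≤ n ∧ arc l v = {m | m ≠ m₀ ∧ c m = b} ∧
        (m₀ = l + (v : ZMod n) ∨ m₀ = l - 1)) := by
  obtain ⟨N, rfl⟩ : ∃ N, n = N + 2 := ⟨n - 2, by omega⟩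
  have hnat : ((N : ZMod (N + 2)) + 2) = 0 := by
    have : ((N + 2 : ℕ) : ZMod (N + 2)) = 0 := ZMod.natCast_self _
    push_cast at this
    exact this
  set D : Finset (ZMod (N + 2)) := {m | m ≠ m₀ ∧ m + 1 ≠ m₀ ∧ c m ≠ c (m + 1)} with hD
  have hge : ∀ p, #D + (if F p m₀ ≠ c (m₀ + 1) then 1 else 0) +
      (if F p m₀ ≠ c (m₀ - 1) then 1 else 0) ≤ changes (F p) :=
    fun p => changes_ge_of_eq_off hn (hF p)
  -- Two changes of `c` away from `m₀` use up the budget of two on every line, so at most `e` lines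
  -- can change again next to `m₀`.
  by_cases hD2 : 2 ≤ #D
  · left
    refine ⟨c (m₀ + 1), ?_⟩
    have : ∑ p, (2 + if F p m₀ ≠ c (m₀ + 1) then 1 else 0) ≤ ∑ p, changes (F p) :=
      Finset.sum_le_sum fun p _ => by have := hge p; omega
    rw [Finset.sum_add_distrib, ← Finset.card_filter] at this
    simp only [Finset.sum_const, Finset.card_univ, smul_eq_mul] at this
    omega
  right
  set s : ℕ → S := fun j => c (m₀ + 1 + (j : ZMod (N + 2))) with hs
  have hoff : ∀ j : ℕ, j < N + 1 → m₀ + 1 + (j : ZMod (N + 2)) ≠ m₀ := by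
    intro j hj h
    refine natCast_ne_zero_of_lt (Nat.succ_pos j) (show j + 1 < N + 2 by omega) ?_
    push_cast; linear_combination h
  have hrep : ∀ m, m ≠ m₀ → ∃ j : ℕ, j ≤ N ∧ m = m₀ + 1 + (j : ZMod (N + 2)) := by
    intro m hm
    obtain ⟨j, hj, rfl⟩ := exists_add_natCast (m₀ + 1) m
    refine ⟨j, ?_, rfl⟩
    by_contra hc
    obtain rfl : j = N + 1 := by omega
    apply hm
    push_cast; linear_combination hnat
  have hsN : s N = c (m₀ - 1) := by
    simp only [hs]; congr 1; linear_combination hnat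
  have hs0 : s 0 = c (m₀ + 1) := by simp [hs]
  have hmem : ∀ j : ℕ, j < N → s j ≠ s (j + 1) → m₀ + 1 + (j : ZMod (N + 2)) ∈ D := by
    intro j hj hne
    have e1 : m₀ + 1 + (j : ZMod (N + 2)) + 1 = m₀ + 1 + ((j + 1 : ℕ) : ZMod (N + 2)) := by
      push_cast; ring
    rw [hD, Finset.mem_filter]
    refine ⟨Finset.mem_univ _, hoff j (by omega), ?_, ?_⟩
    · rw [e1]; exact hoff (j + 1) (by omega)
    · rw [e1]; exact hne
  have hcard : #{j ∈ range N | s j ≠ s (j + 1)} ≤ 1 := by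
    refine le_trans (Finset.card_le_card_of_injOn (fun j => m₀ + 1 + (j : ZMod (N + 2))) ?_ ?_)
      (show #D ≤ 1 by omega)
    · intro j hj
      simp only [Finset.coe_filter, Finset.mem_range, Set.mem_ofPred_eq] at hj
      exact hmem j hj.1 hj.2
    · intro i hi j hj hij
      simp only [Finset.coe_filter, Finset.mem_range, Set.mem_ofPred_eq] at hi hj
      exact natCast_inj_of_lt (by omega) (by omega) (add_left_cancel hij)
  obtain ⟨j₀, hj₀, h1, h2⟩ := exists_split_of_single_change s N hcard
  -- The sequence `s` reads `c` along the cycle cut at `m₀`; it has at most one change, and its end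
  -- values are those at the two neighbours of `m₀`.
  by_cases hab : c (m₀ + 1) = c (m₀ - 1)
  · left
    refine ⟨c (m₀ + 1), fun m hm => ?_⟩
    obtain ⟨j, hj, rfl⟩ := hrep m hm
    by_cases hjj : j ≤ j₀
    · exact (h1 j hjj).trans hs0
    · exact ((h2 j (by omega) hj).trans hsN).trans hab.symm
  right
  have hj₀N : j₀ < N := by
    refine lt_of_le_of_ne hj₀ ?_
    rintro rfl
    exact hab (hs0.symm.trans ((h1 _ le_rfl).symm.trans hsN))
  have hDpos : 1 ≤ #D := by
    refine Finset.card_pos.2 ⟨_, hmem j₀ hj₀N ?_⟩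
    rw [h1 _ le_rfl, h2 _ (Nat.lt_succ_self _) hj₀N, hs0, hsN]
    exact hab
  refine ⟨c (m₀ + 1), c (m₀ - 1), hab, fun m hm => ?_, ?_, ⟨m₀ + 1, j₀ + 1, by omega, ?_, ?_⟩,
    ⟨m₀ + 1 + ((j₀ + 1 : ℕ) : ZMod (N + 2)), N - j₀, by omega, ?_, ?_⟩⟩
  · obtain ⟨j, hj, rfl⟩ := hrep m hm
    by_cases hjj : j ≤ j₀
    · exact Or.inl ((h1 j hjj).trans hs0)
    · exact Or.inr ((h2 j (by omega) hj).trans hsN)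
  -- The passage between the two arcs gives one change. A value at `m₀` equal to one of the
  -- neighbouring values adds one more, any other value adds two.
  · have : ∑ p, (2 + if F p m₀ ≠ c (m₀ + 1) ∧ F p m₀ ≠ c (m₀ - 1) then 1 else 0) ≤
        ∑ p, changes (F p) := by
      refine Finset.sum_le_sum fun p _ => ?_
      have := hge p
      by_cases ha : F p m₀ = c (m₀ + 1)
      · simp [ha, hab] at this ⊢; omega
      · by_cases hb : F p m₀ = c (m₀ - 1)
        · simp [hb] at this ⊢
          rw [if_neg (fun h => hab h.symm)] at this
          omega
        · simp [hb] at this ⊢; omega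
    rw [Finset.sum_add_distrib, ← Finset.card_filter] at this
    simp only [Finset.sum_const, Finset.card_univ, smul_eq_mul] at this
    omega
  · ext m
    constructor
    · rintro ⟨j, hj, rfl⟩
      exact ⟨hoff j (by omega), (h1 j (by omega)).trans hs0⟩
    · rintro ⟨hm, hc⟩
      obtain ⟨j, hj, rfl⟩ := hrep m hm
      refine ⟨j, ?_, rfl⟩
      by_contra hlt
      exact hab (hc.symm.trans ((h2 j (by omega) hj).trans hsN))
  · right; ring
  · ext m
    constructor
    · rintro ⟨j, hj, rfl⟩
      have e1 : m₀ + 1 + ((j₀ + 1 : ℕ) : ZMod (N + 2)) + (j : ZMod (N + 2)) =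
        m₀ + 1 + ((j₀ + 1 + j : ℕ) : ZMod (N + 2)) := by push_cast; ring
      rw [e1]
      exact ⟨hoff _ (by omega), (h2 _ (by omega) (by omega)).trans hsN⟩
    · rintro ⟨hm, hc⟩
      obtain ⟨j, hj, rfl⟩ := hrep m hm
      have hlt : j₀ < j := by
        by_contra hlt
        exact hab (((h1 j (by omega)).trans hs0).symm.trans hc)
      refine ⟨j - (j₀ + 1), by omega, ?_⟩
      have : j = j₀ + 1 + (j - (j₀ + 1)) := by omega
      conv_lhs => rw [this]
      push_cast; ring
  · left
    have : ((N - j₀ : ℕ) : ZMod (N + 2)) = (N : ZMod (N + 2)) - (j₀ : ZMod (N + 2)) := by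
      rw [Nat.cast_sub hj₀]
    rw [this]
    push_cast
    linear_combination -hnat

end Stack

/-! ### Isoperimetry in the plane -/

section Plane

open Finset
open scoped Classical

variable {S : Type*} {X Y : ℕ} [NeZero X] [NeZero Y]

/-- The energy of a two-dimensional configuration, summed over the lines of both directions. -/
noncomputable def planeEnergy (f : ZMod X → ZMod Y → S) : ℕ :=
  ∑ y, changes (fun x => f x y) + ∑ x, changes (f x)

theorem planeEnergy_swap (f : ZMod X → ZMod Y → S) :
    planeEnergy (fun y x => f x y) = planeEnergy f := by
  unfold planeEnergy; rw [add_comm]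

theorem exists_const_of_sum_lt {ι : Type*} [Fintype ι] {n : ℕ} [NeZero n] {g : ι → ZMod n → S}
    (h : ∑ i, changes (g i) < 2 * Fintype.card ι) : ∃ i, ∀ a b, g i a = g i b := by
  by_contra hc
  push Not at hc
  have : ∑ _i : ι, 2 ≤ ∑ i, changes (g i) := Finset.sum_le_sum fun i _ => by
    obtain ⟨a, b, hab⟩ := hc i
    exact two_le_changes hab
  simp at this
  omega

theorem two_mul_card_le_sum_changes {ι : Type*} [Fintype ι] {n : ℕ} [NeZero n]
    {g : ι → ZMod n → S} (p : ι → Prop) [DecidablePred p] (h : ∀ i, p i → ∃ a b, g i a ≠ g i b) :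
    2 * #{i | p i} ≤ ∑ i, changes (g i) := by
  rw [Finset.card_filter, Finset.mul_sum]
  refine Finset.sum_le_sum fun i _ => ?_
  split_ifs with hi
  · obtain ⟨a, b, hab⟩ := h i hi
    exact two_le_changes hab
  · simp

/-- A configuration with a constant line in both directions agrees with the common value off a
set whose size is controlled by the energy. -/
theorem card_ne_le_of_cross {f : ZMod X → ZMod Y → S} {x₀ : ZMod X} {y₀ : ZMod Y}
    (hx : ∀ y y', f x₀ y = f x₀ y') (hy : ∀ x x', f x y₀ = f x' y₀) :
    16 * #{p : ZMod X × ZMod Y | f p.1 p.2 ≠ f x₀ y₀} ≤ planeEnergy f ^ 2 := by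
  set s := f x₀ y₀ with hs
  set R : Finset (ZMod Y) := {y | ∃ x, f x y ≠ s}
  set C : Finset (ZMod X) := {x | ∃ y, f x y ≠ s}
  -- A line containing a deviating site also meets the cross, so it is not constant.
  have hR : 2 * #R ≤ ∑ y, changes (fun x => f x y) :=
    two_mul_card_le_sum_changes (g := fun y x => f x y) (fun y => ∃ x, f x y ≠ s)
      fun y ⟨x, hxy⟩ => ⟨x, x₀, fun h => hxy (h.trans (hx y y₀))⟩
  have hC : 2 * #C ≤ ∑ x, changes (f x) :=
    two_mul_card_le_sum_changes (g := f) (fun x => ∃ y, f x y ≠ s)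
      fun x ⟨y, hxy⟩ => ⟨y, y₀, fun h => hxy (h.trans (hy x x₀))⟩
  have hsub : #{p : ZMod X × ZMod Y | f p.1 p.2 ≠ s} ≤ #C * #R := by
    rw [← Finset.card_product]
    refine Finset.card_le_card fun p hp => ?_
    simp only [Finset.mem_filter, Finset.mem_univ, true_and] at hp
    simp only [Finset.mem_product, C, R, Finset.mem_filter, Finset.mem_univ, true_and]
    exact ⟨⟨_, hp⟩, ⟨_, hp⟩⟩
  have hE : 2 * #R + 2 * #C ≤ planeEnergy f := by unfold planeEnergy; omega
  have hpow := Nat.pow_le_pow_left hE 2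
  have hamgm : 4 * (#C * #R) ≤ (#R + #C) ^ 2 := by
    zify
    linarith [sq_nonneg ((#R : ℤ) - #C)]
  calc 16 * #{p : ZMod X × ZMod Y | f p.1 p.2 ≠ s} ≤ 4 * (4 * (#C * #R)) := by omega
    _ ≤ 4 * (#R + #C) ^ 2 := Nat.mul_le_mul_left 4 hamgm
    _ = (2 * #R + 2 * #C) ^ 2 := by ring
    _ ≤ planeEnergy f ^ 2 := hpow

/-- If all rows or all columns were non-constant, each would cost 2, so both bounds together provide
a cross. -/
theorem exists_cross_of_lt {f : ZMod X → ZMod Y → S} (h1 : planeEnergy f < 2 * X)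
    (h2 : planeEnergy f < 2 * Y) :
    ∃ s, 16 * #{p : ZMod X × ZMod Y | f p.1 p.2 ≠ s} ≤ planeEnergy f ^ 2 := by
  obtain ⟨x₀, hx⟩ : ∃ x, ∀ a b, f x a = f x b := exists_const_of_sum_lt (by
    rw [ZMod.card]; unfold planeEnergy at h1; omega)
  obtain ⟨y₀, hy⟩ : ∃ y, ∀ a b, (fun x => f x y) a = (fun x => f x y) b :=
    exists_const_of_sum_lt (g := fun y x => f x y) (by
      rw [ZMod.card]; unfold planeEnergy at h2; omega)
  exact ⟨_, card_ne_le_of_cross hx hy⟩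

/-- The number of sites whose spin lies in `B`. -/
noncomputable def siteCount (B : Set S) (f : ZMod X → ZMod Y → S) : ℕ :=
  #{p : ZMod X × ZMod Y | f p.1 p.2 ∈ B}

theorem siteCount_le_of_forall_eq_off {B : Set S} {f : ZMod X → ZMod Y → S} {y₀ : ZMod Y} {a : S}
    (h : ∀ x y, y ≠ y₀ → f x y = a) (ha : a ∉ B) :
    siteCount B f ≤ X := by
  unfold siteCount
  calc #{p : ZMod X × ZMod Y | f p.1 p.2 ∈ B}
      ≤ #((univ : Finset (ZMod X)) ×ˢ {y₀}) := by
        refine Finset.card_le_card fun p hp => ?_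
        simp only [Finset.mem_filter, Finset.mem_univ, true_and] at hp
        simp only [Finset.mem_product, Finset.mem_univ, true_and, Finset.mem_singleton]
        by_contra hc
        exact ha (h p.1 p.2 hc ▸ hp)
    _ = X := by simp [ZMod.card]

end Plane

end Potts3D

namespace Potts3D

/-! ### Planar configurations of minimal energy -/

section Strip

open Finset
open scoped Classical

variable {S : Type*} {K L : ℕ} [NeZero K] [NeZero L]

theorem siteCount_of_row_const {B : Set S} {f : ZMod K → ZMod L → S}
    (h : ∀ y x x', f x y = f x' y) : siteCount B f = K * #{y | f 0 y ∈ B} := by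
  unfold siteCount
  have : ({p : ZMod K × ZMod L | f p.1 p.2 ∈ B} : Finset _) =
      (univ : Finset (ZMod K)) ×ˢ ({y | f 0 y ∈ B} : Finset (ZMod L)) := by
    ext p
    simp [h p.2 p.1 0]
  rw [this, Finset.card_product, Finset.card_univ, ZMod.card]

theorem siteCount_add_compl (B : Set S) (f : ZMod K → ZMod L → S) :
    siteCount B f + siteCount Bᶜ f = K * L := by
  have := Finset.card_filter_add_card_filter_not (s := (univ : Finset (ZMod K × ZMod L)))
    (fun p => f p.1 p.2 ∈ B)
  simp only [Finset.card_univ, Fintype.card_prod, ZMod.card] at this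
  rw [← this]
  unfold siteCount
  congr!

theorem card_filter_mem_arc (l : ZMod L) {v : ℕ} (hv : v ≤ L) :
    #{y : ZMod L | y ∈ arc l v} = v := by
  rw [← Set.ncard_coe_finset]
  simp [ncard_arc l hv]

/-- The configurations with a complete set of non-constant columns and minimal energy are strips
with an incomplete line attached. -/
theorem strip_of_columns (hL : 3 ≤ L) {B : Set S} {f : ZMod K → ZMod L → S} {r : ℕ}
    (hr : siteCount B f = r) (hr1 : 3 * K ≤ r)
    (hr2 : r + 3 * K ≤ K * L) (hdK : ¬ K ∣ r) (hcol : ∀ x, ∃ y y', f x y ≠ f x y') :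
    2 * K + 2 ≤ planeEnergy f ∧ (planeEnergy f ≤ 2 * K + 2 →
      ∃ a b, a ∉ B ∧ b ∈ B ∧ (∀ x y, f x y = a ∨ f x y = b) ∧ ∃ v, 2 ≤ v ∧ v + 3 ≤ L ∧
        ∃ (l : ZMod L) (k : ZMod K) (h : ℕ), 1 ≤ h ∧ h + 1 ≤ K ∧
          ((fun p : Site2 K L => f p.1 p.2) = xiPlus K L a b l v k h ∨
            (fun p : Site2 K L => f p.1 p.2) = xiMinus K L a b l v k h)) := by
  have hKpos : 0 < K := Nat.pos_of_ne_zero (NeZero.ne K)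
  -- If all rows were constant, the volume would be a multiple of `K`.
  have hrow : ∃ y₀, ∃ x x', f x y₀ ≠ f x' y₀ := by
    by_contra hc
    push Not at hc
    exact hdK ⟨_, hr.symm.trans (siteCount_of_row_const hc)⟩
  obtain ⟨y₀, x₁, x₂, hx12⟩ := hrow
  have hcols : 2 * K ≤ ∑ x, changes (f x) := by
    have := two_mul_card_le_sum_changes (g := f) (fun _ => True) (fun x _ => hcol x)
    simpa [ZMod.card] using this
  have hrow0 : 2 ≤ changes (fun x => f x y₀) :=
    two_le_changes (f := fun x => f x y₀) hx12
  have hrows : changes (fun x => f x y₀) ≤ ∑ y, changes (fun x => f x y) :=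
    Finset.single_le_sum (f := fun y => changes (fun x => f x y)) (fun _ _ => Nat.zero_le _)
      (Finset.mem_univ y₀)
  refine ⟨by unfold planeEnergy; omega, fun hE => ?_⟩
  unfold planeEnergy at hE
  -- A second non-constant row would raise the energy to 2K + 4.
  have hoff : ∀ x y, y ≠ y₀ → f x y = f 0 y := by
    intro x y hy
    by_contra hne
    have := two_mul_card_le_sum_changes (g := fun y x => f x y) (fun y' => y' = y ∨ y' = y₀) (by
      rintro y' (rfl | rfl)
      · exact ⟨_, _, hne⟩
      · exact ⟨_, _, hx12⟩)
    have h2 : #{y' | y' = y ∨ y' = y₀} = 2 := by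
      rw [← Finset.card_pair hy]; congr 1; ext; simp
    rw [h2] at this
    omega
  have hcompl := siteCount_add_compl B f
  have hfull : ∀ C : Set S, (∀ x y, f x y ∈ C) → siteCount C f = K * L := by
    intro C hC
    unfold siteCount
    simp [hC, ZMod.card]
  -- The row `y₀` takes 2 of the budget, which leaves exactly 2 per column: hence `e = 0`.
  rcases stack_cases (P := ZMod K) hL (F := f) (c := fun y => f 0 y) (m₀ := y₀) (e := 0)
    hoff (by rw [ZMod.card]; omega) with ⟨a, ha⟩ | ⟨a, ha⟩ | ⟨a, b, hab, hcab, hcard, harca, harcb⟩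
  · exfalso
    simp only [Nat.le_zero, Finset.card_eq_zero, Finset.filter_eq_empty_iff, Finset.mem_univ,
      not_not, true_implies] at ha
    exact hx12 ((@ha x₁).trans (@ha x₂).symm)
  · exfalso
    by_cases haB : a ∈ B
    · have := siteCount_le_of_forall_eq_off (B := Bᶜ) (f := f) (y₀ := y₀) (a := a)
        (fun x y hy => (hoff x y hy).trans (ha y hy)) (by simpa using haB)
      omega
    · have := siteCount_le_of_forall_eq_off (B := B) (f := f) (y₀ := y₀) (a := a)
        (fun x y hy => (hoff x y hy).trans (ha y hy)) haB
      omega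
  · have hval : ∀ x y, f x y = a ∨ f x y = b := by
      intro x y
      by_cases hy : y = y₀
      · subst hy
        simp only [Nat.le_zero, Finset.card_eq_zero, Finset.filter_eq_empty_iff, Finset.mem_univ,
          true_implies] at hcard
        have := @hcard x
        tauto
      · rw [hoff x y hy]; exact hcab y hy
    -- The two values play symmetric roles. They cannot lie on the same side of `B`, since the
    -- volume would then be 0 or KL; `b` names the one in `B`.
    obtain ⟨a, b, haB, hbB, hval, l, v, hv, harc, hy₀⟩ : ∃ a b, a ∉ B ∧ b ∈ B ∧
        (∀ x y, f x y = a ∨ f x y = b) ∧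
        ∃ (l : ZMod L) (v : ℕ), v + 2 ≤ L ∧ arc l v = {m | m ≠ y₀ ∧ f 0 m = b} ∧
        (y₀ = l + (v : ZMod L) ∨ y₀ = l - 1) := by
      by_cases haB : a ∈ B <;> by_cases hbB : b ∈ B
      · have := hfull B (fun x y => by rcases hval x y with h | h <;> rw [h] <;> assumption)
        omega
      · exact ⟨b, a, hbB, haB, fun x y => (hval x y).symm, harca⟩
      · exact ⟨a, b, haB, hbB, hval, harcb⟩
      · have := hfull Bᶜ (fun x y => by rcases hval x y with h | h <;> rw [h] <;> assumption)
        omega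
    have hne : a ≠ b := fun h => haB (h ▸ hbB)
    have hiff : ∀ x y, f x y ∈ B ↔ f x y = b := fun x y =>
      ⟨fun h => (hval x y).resolve_left (fun h' => haB (h' ▸ h)), fun h => h ▸ hbB⟩
    have hmemarc : ∀ x y, y ≠ y₀ → (f x y = b ↔ y ∈ arc l v) := by
      intro x y hy
      rw [harc, hoff x y hy]; simp [hy]
    have hy₀arc : y₀ ∉ arc l v := by rw [harc]; simp
    have hlow : K * v ≤ r := by
      rw [← hr, ← card_filter_mem_arc l (show v ≤ L by omega)]; unfold siteCount
      calc _ = #((univ : Finset (ZMod K)) ×ˢ ({y | y ∈ arc l v} : Finset (ZMod L))) := by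
            rw [Finset.card_product, Finset.card_univ, ZMod.card]
        _ ≤ _ := Finset.card_le_card fun p hp => by
            simp only [Finset.mem_product, Finset.mem_univ, true_and, Finset.mem_filter] at hp ⊢
            exact (hiff _ _).2 ((hmemarc _ _ (fun h => hy₀arc (h ▸ hp))).2 hp)
    have hupp : r ≤ K * (v + 1) := by
      rw [← hr]; unfold siteCount
      calc _ ≤ #((univ : Finset (ZMod K)) ×ˢ
            (insert y₀ ({y | y ∈ arc l v} : Finset (ZMod L)))) :=
            Finset.card_le_card fun p hp => by
              simp only [Finset.mem_product, Finset.mem_univ, true_and, Finset.mem_filter,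
                Finset.mem_insert] at hp ⊢
              by_cases h : p.2 = y₀
              · exact Or.inl h
              · exact Or.inr ((hmemarc _ _ h).1 ((hiff _ _).1 hp))
        _ ≤ _ := by
            rw [Finset.card_product, Finset.card_univ, ZMod.card]
            refine Nat.mul_le_mul_left K ((Finset.card_insert_le _ _).trans ?_)
            rw [card_filter_mem_arc l (show v ≤ L by omega)]
    -- The bounds Kv ≤ r ≤ K(v + 1) and 3K ≤ r ≤ KL - 3K confine the width of the strip.
    have hv2 : 2 ≤ v := by
      by_contra hlt
      have : K * (v + 1) ≤ K * 2 := Nat.mul_le_mul_left K (by omega)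
      omega
    have hv3 : v + 3 ≤ L := by
      by_contra hlt
      have : K * L ≤ K * (v + 2) := Nat.mul_le_mul_left K (by omega)
      have e : K * (v + 2) = K * v + 2 * K := by ring
      omega
    obtain ⟨k, h, hh1, hh2, hbar⟩ := exists_arc_of_changes_le_two (g := fun x => f x y₀) hne
      (fun x => hval x y₀)
      (by
        rcases hval x₁ y₀ with h | h
        · exact ⟨_, h⟩
        · rcases hval x₂ y₀ with h' | h'
          · exact ⟨_, h'⟩
          · exact absurd (h.trans h'.symm) hx12)
      (by
        rcases hval x₁ y₀ with h | h
        · rcases hval x₂ y₀ with h' | h'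
          · exact absurd (h.trans h'.symm) hx12
          · exact ⟨_, h'⟩
        · exact ⟨_, h⟩)
      (by omega)
    have hform : (fun p : Site2 K L => f p.1 p.2) =
        twoSpin a b {x | x.2 ∈ arc l v ∨ (x.1 ∈ arc k h ∧ x.2 = y₀)} := by
      funext p
      have hp : f p.1 p.2 = b ↔ p ∈ {x : Site2 K L | x.2 ∈ arc l v ∨ (x.1 ∈ arc k h ∧ x.2 = y₀)} := by
        simp only [Set.mem_ofPred_eq]
        by_cases hpy : p.2 = y₀
        · have := hbar p.1
          simp only [hpy, hy₀arc, false_or, and_true]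
          exact this
        · simp only [hpy, and_false, or_false]
          exact hmemarc _ _ hpy
      unfold twoSpin
      split_ifs with hmem
      · exact hp.2 hmem
      · exact (hval _ _).resolve_right (fun h => hmem (hp.1 h))
    refine ⟨a, b, haB, hbB, hval, v, hv2, hv3, l, k, h, hh1, hh2, ?_⟩
    rw [hform]
    rcases hy₀ with rfl | rfl
    · exact Or.inl rfl
    · exact Or.inr rfl

theorem siteCount_swap (B : Set S) (f : ZMod K → ZMod L → S) :
    siteCount B (fun y x => f x y) = siteCount B f :=
  Finset.card_bij' (fun p _ => p.swap) (fun p _ => p.swap) (by simp) (by simp) (by simp) (by simp)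

/-- Three cases: all columns are non-constant, all rows are, or there is a cross. The first, and for
K = L also the second, produces a strip with a bar. A cross makes the minority volume at most (K +
1)²/4 at energy 2K + 2, which `hr3` and `hr4` exclude. -/
theorem plane_gateway (hK : 3 ≤ K) (hKL : K ≤ L) {B : Set S} {f : ZMod K → ZMod L → S} {r : ℕ}
    (hr : siteCount B f = r) (hr1 : 3 * K ≤ r)
    (hr2 : r + 3 * K ≤ K * L) (hr3 : (K + 1) ^ 2 < 4 * r) (hr4 : (K + 1) ^ 2 + 4 * r < 4 * (K * L))
    (hdK : ¬ K ∣ r) (hdL : ¬ L ∣ r) :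
    2 * K + 2 ≤ planeEnergy f ∧ (planeEnergy f ≤ 2 * K + 2 →
      ∃ a b, a ∉ B ∧ b ∈ B ∧ (∀ x y, f x y = a ∨ f x y = b) ∧
        (fun p : Site2 K L => f p.1 p.2) ∈ bulkGamma2 K L a b) := by
  by_cases hcol : ∀ x, ∃ y y', f x y ≠ f x y'
  · obtain ⟨h1, h2⟩ := strip_of_columns (hK.trans hKL) hr hr1 hr2 hdK hcol
    refine ⟨h1, fun hE => ?_⟩
    obtain ⟨a, b, ha, hb, hab, v, hv2, hv3, hmem⟩ := h2 hE
    exact ⟨a, b, ha, hb, hab, v, hv2, hv3, Or.inl hmem⟩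
  by_cases hrow : ∀ y, ∃ x x', f x y ≠ f x' y
  · rcases hKL.eq_or_lt with rfl | hlt
    · obtain ⟨h1, h2⟩ := strip_of_columns (f := fun y x => f x y) hK
        ((siteCount_swap B f).trans hr) hr1 hr2 hdK hrow
      rw [planeEnergy_swap] at h1 h2
      refine ⟨h1, fun hE => ?_⟩
      obtain ⟨a, b, ha, hb, hab, v, hv2, hv3, hmem⟩ := h2 hE
      refine ⟨a, b, ha, hb, fun x y => hab y x, v, hv2, hv3, Or.inr ⟨rfl, ?_⟩⟩
      refine ⟨_, hmem, ?_⟩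
      funext p
      simp [transpose, ZMod.ringEquivCongr_refl]
    -- For K < L this case costs at least 2L + 2, where the last 2 comes from a non-constant column
    -- forced by `hdL`.
    · have hrows : 2 * L ≤ ∑ y, changes (fun x => f x y) := by
        have := two_mul_card_le_sum_changes (g := fun y x => f x y) (fun _ => True)
          (fun x _ => hrow x)
        simpa [ZMod.card] using this
      have hcol' : ∃ x, ∃ y y', f x y ≠ f x y' := by
        by_contra hc
        push Not at hc
        exact hdL ⟨_, hr.symm.trans ((siteCount_swap B f).symm.trans
          (siteCount_of_row_const (f := fun y x => f x y) hc))⟩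
      obtain ⟨x, y, y', hne⟩ := hcol'
      have h2 := two_le_changes hne
      have h3 : changes (f x) ≤ ∑ x, changes (f x) :=
        Finset.single_le_sum (f := fun x => changes (f x)) (fun _ _ => Nat.zero_le _)
          (Finset.mem_univ x)
      unfold planeEnergy
      constructor
      · omega
      · intro; omega
  push Not at hcol hrow
  obtain ⟨x₀, hx₀⟩ := hcol
  obtain ⟨y₀, hy₀⟩ := hrow
  have hcross := card_ne_le_of_cross hx₀ hy₀
  have hcompl := siteCount_add_compl B f
  have hbig : 2 * K + 3 ≤ planeEnergy f := by
    by_contra hlt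
    have hpow : planeEnergy f ^ 2 ≤ (2 * (K + 1)) ^ 2 := Nat.pow_le_pow_left (by omega) 2
    rw [mul_pow] at hpow
    have hsub : ∀ C : Set S, f x₀ y₀ ∉ C → siteCount C f ≤
        #{p : ZMod K × ZMod L | f p.1 p.2 ≠ f x₀ y₀} := fun C hC =>
      Finset.card_le_card fun p hp => by
        simp only [Finset.mem_filter, Finset.mem_univ, true_and] at hp ⊢
        exact fun h => hC (h ▸ hp)
    by_cases hB : f x₀ y₀ ∈ B
    · have := hsub Bᶜ (by simpa using hB)
      omega
    · have := hsub B hB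
      omega
  exact ⟨by omega, fun h => by omega⟩

end Strip

end Potts3D

namespace Potts3D

/-! ### Volume and energy balance with one kind of light floor -/

section Arithmetic

open Finset

/-- Here ρ is the fraction of heavy floors, v the filling of the fullest heavy floor, u that of some
light floor and s the volume share of the light floors; energies are in units of 2KL. As ρv ≤ (ρ +
v)²/4, the volume is at most (1.251 - 4s)²/4 + s. This is convex in s and below 0.49 at s = 0 and s
= 1/4. -/
theorem one_sided_real {ρ v s u : ℝ} (hs0 : 0 ≤ s) (hs1 : s ≤ 1 / 4) (hu : u ≤ 1 / 4)
    (hvol : 49 / 100 ≤ ρ * v + s) (hE : ρ + 4 * s + v - u ≤ 1001 / 1000) (hρ : 0 ≤ ρ) (hv : 0 ≤ v) :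
    False := by
  have h1 : ρ + v ≤ 1.251 - 4 * s := by linarith
  have h2 : (ρ + v) ^ 2 ≤ (1.251 - 4 * s) ^ 2 := pow_le_pow_left₀ (by positivity) h1 2
  nlinarith [sq_nonneg (ρ - v), mul_nonneg hs0 (sub_nonneg.2 hs1)]

/-- Since s ≥ Au, the net cost 4s - u is at least (4A - 1)u, whose sign is decided at A = 1/4. -/
theorem light_share_ge {A s u : ℝ} (hu0 : 0 ≤ u) (hu : u ≤ 1 / 4) (hs : A * u ≤ s) :
    (1 / 4 ≤ A → u ≤ 4 * s) ∧ (A ≤ 1 / 4 → A - 1 / 4 ≤ 4 * s - u) :=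
  ⟨fun h => by nlinarith, fun h => by nlinarith⟩

/-- A and B are the fractions of nearly empty and nearly full floors, h that of heavy ones, and s, t
the misplaced volume in the first two kinds. If A or B were below 0.3, the volume balance would
require many heavy floors or much misplaced volume, and either costs more than ε. With both at least
0.3, 4s - u ≥ u/5 and 4t - w ≥ w/5. -/
theorem two_sided_real {A B h s t u w ε : ℝ} (hsum : A + B + h = 1) (hh : 0 ≤ h)
    (hu0 : 0 ≤ u) (hu : u ≤ 1 / 4) (hs : A * u ≤ s) (hw0 : 0 ≤ w) (hw : w ≤ 1 / 4) (ht : B * w ≤ t)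
    (hv1 : 49 / 100 ≤ B + h + s) (hv2 : 49 / 100 ≤ A + h + t)
    (hE : h + 4 * s + 4 * t - u - w ≤ ε) (hε : ε ≤ 1 / 1000) :
    3 / 10 ≤ A ∧ 3 / 10 ≤ B ∧ u + w ≤ 5 * ε := by
  obtain ⟨a1, a2⟩ := light_share_ge hu0 hu hs
  obtain ⟨b1, b2⟩ := light_share_ge hw0 hw ht
  have hA3 : 3 / 10 ≤ A := by
    by_contra hlt
    push Not at hlt
    rcases le_total (1 / 4) A with hA4 | hA4 <;> rcases le_total (1 / 4) B with hB4 | hB4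
    · have := a1 hA4; have := b1 hB4; linarith
    · have := a1 hA4; have := b2 hB4; linarith
    · have := a2 hA4; have := b1 hB4; linarith
    · have := a2 hA4; have := b2 hB4; linarith
  have hB3 : 3 / 10 ≤ B := by
    by_contra hlt
    push Not at hlt
    rcases le_total (1 / 4) A with hA4 | hA4 <;> rcases le_total (1 / 4) B with hB4 | hB4
    · have := a1 hA4; have := b1 hB4; linarith
    · have := a1 hA4; have := b2 hB4; linarith
    · have := a2 hA4; have := b1 hB4; linarith
    · have := a2 hA4; have := b2 hB4; linarith
  refine ⟨hA3, hB3, ?_⟩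
  nlinarith

/-- Normalisation to `one_sided_real`: floor counts are divided by z, volumes by a or az, energies
by 2KL. -/
theorem one_sided_real_count {K L W a z nH nL sA eL eH Pil N v₁ v₂ : ℝ}
    (ha' : 0 < a) (hz' : 0 < z) (hW' : 0 < W) (hK' : 2829 ≤ K) (hL' : K ≤ L)
    (hnL : 0 ≤ nL) (hnH : 0 ≤ nH) (hsA : 0 ≤ sA) (heL : 0 ≤ eL) (hv₂ : 0 ≤ v₂)
    (r1 : 2 * W * nH ≤ eH) (r2 : 8 * sA ≤ W * eL) (r3 : eL + eH + Pil ≤ 2 * (K * L) + 2 * K + 2)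
    (r4 : 2 * v₂ ≤ Pil + 2 * v₁) (r5 : 4 * v₁ ≤ a) (r6 : N ≤ sA + nH * v₂)
    (r7 : 49 * (a * z) ≤ 100 * N) (r8 : 4 * sA ≤ nL * a) (r9 : nL + nH = z) (r10 : W ^ 2 ≤ a)
    (r11 : K * L ≤ W * z) (r12 : K * L ≤ a) : False := by
  have hKL' : 0 < K * L := by nlinarith
  have hs1 : sA / (a * z) ≤ 1 / 4 := by
    rw [div_le_iff₀ (by positivity)]
    calc sA ≤ nL * a / 4 := by linarith
      _ ≤ z * a / 4 := by gcongr; linarith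
      _ = 1 / 4 * (a * z) := by ring
  have hu1 : v₁ / a ≤ 1 / 4 := by rw [div_le_iff₀ ha']; linarith
  have hvol : (49 / 100 : ℝ) ≤ nH / z * (v₂ / a) + sA / (a * z) := by
    rw [div_mul_div_comm, mul_comm (z : ℝ) a, ← add_div, le_div_iff₀ (by positivity)]
    linarith
  refine one_sided_real (ρ := nH / z) (v := v₂ / a) (s := sA / (a * z)) (u := v₁ / a)
    (by positivity) hs1 hu1 hvol ?_ (by positivity) (by positivity)
  -- Needed to replace a by the smaller KL in the pillar term. If the fullest heavy floor were at
  -- most a quarter full, the total filling would not reach 0.49.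
  have hvu : 0 ≤ v₂ / a - v₁ / a := by
    have hs2 : sA / (a * z) ≤ 1 / 4 - nH / z * (1 / 4) := by
      have : (1 / 4 : ℝ) - nH / z * (1 / 4) = nL / (4 * z) := by
        obtain rfl : nL = z - nH := by linarith
        field_simp
      rw [this, div_le_div_iff₀ (by positivity) (by positivity)]
      calc sA * (4 * z) = 4 * sA * z := by ring
        _ ≤ nL * a * z := by gcongr
        _ = nL * (a * z) := by ring
    by_contra hc
    have hV : v₂ / a ≤ 1 / 4 := by linarith
    have : nH / z * (v₂ / a) ≤ nH / z * (1 / 4) := by gcongr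
    linarith
  have q1 : 8 * (W * z) * (sA / (a * z)) ≤ eL := by
    have : 8 * (W * z) * (sA / (a * z)) = W * (8 * sA) / a := by field_simp
    rw [this, div_le_iff₀ ha']
    calc W * (8 * sA : ℝ) ≤ W * (W * eL) := by gcongr
      _ = eL * W ^ 2 := by ring
      _ ≤ eL * a := by gcongr
  have q2 : 2 * (W * z) * (nH / z) ≤ eH := by
    have : 2 * (W * z) * (nH / z) = 2 * W * nH := by field_simp
    linarith
  have q3 : 2 * a * (v₂ / a - v₁ / a) ≤ Pil := by
    have : 2 * a * (v₂ / a - v₁ / a) = 2 * v₂ - 2 * v₁ := by field_simp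
    linarith
  have q4 : 2 * (K * L) * (nH / z + 4 * (sA / (a * z)) + (v₂ / a - v₁ / a)) ≤
      2 * (K * L) + 2 * K + 2 := by
    have p1 : 2 * (K * L) * (nH / z + 4 * (sA / (a * z))) ≤
        2 * (W * z) * (nH / z + 4 * (sA / (a * z))) := by gcongr
    have p2 : 2 * (K * L) * (v₂ / a - v₁ / a) ≤
        2 * a * (v₂ / a - v₁ / a) := by gcongr
    linarith
  have q5 : (2 : ℝ) * K + 2 ≤ 2 * (K * L) * (1 / 1000) := by nlinarith
  refine le_of_mul_le_mul_left ?_ (by positivity : (0 : ℝ) < 2 * (K * L))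
  linarith

variable {ι : Type*} [Fintype ι]

/-- Makes the quadratic isoperimetric bound linear in the energy, so that it can be summed over
floors. -/
theorem eight_mul_le_of_light {W E x : ℕ} (hE : E < 2 * W) (hx : 16 * x ≤ E ^ 2) :
    8 * x ≤ W * E := by nlinarith

theorem four_mul_le_of_light {W a E x : ℕ} (hWa : W ^ 2 ≤ a) (hE : E < 2 * W)
    (hx : 16 * x ≤ E ^ 2) : 4 * x ≤ a := by nlinarith

/-- Floors of one light type together with heavy floors cannot share the volume evenly. -/
theorem one_sided_false {E v : ι → ℕ} {Pil K L W a N : ℕ} (hK : 2829 ≤ K) (hKL : K ≤ L)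
    (hWa : W ^ 2 ≤ a) (hKLa : K * L ≤ a) (hWz : K * L ≤ W * Fintype.card ι)
    (hPil : ∀ m m', 2 * v m ≤ Pil + 2 * v m') (hN : ∑ m, v m = N)
    (hN1 : 49 * (a * Fintype.card ι) ≤ 100 * N)
    (hH : ∑ m, E m + Pil ≤ 2 * (K * L) + 2 * K + 2)
    (hlight : ∀ m, E m < 2 * W → 16 * v m ≤ E m ^ 2) (hex : ∃ m, E m < 2 * W) : False := by
  set z := Fintype.card ι with hz
  set Hv : Finset ι := {m | ¬ E m < 2 * W}
  set Li : Finset ι := {m | E m < 2 * W}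
  have hLimem : ∀ m ∈ Li, E m < 2 * W := fun m hm => (Finset.mem_filter.1 hm).2
  have hcard : #Li + #Hv = z := by
    rw [hz, ← Finset.card_univ]; exact Finset.card_filter_add_card_filter_not _
  have hsumv : ∑ m ∈ Li, v m + ∑ m ∈ Hv, v m = N := by
    rw [← hN]; exact Finset.sum_filter_add_sum_filter_not _ _ _
  have hsumE : ∑ m ∈ Li, E m + ∑ m ∈ Hv, E m = ∑ m, E m :=
    Finset.sum_filter_add_sum_filter_not _ _ _
  have hEH : #Hv * (2 * W) ≤ ∑ m ∈ Hv, E m := by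
    have := Finset.card_nsmul_le_sum Hv E (2 * W)
      (fun m hm => not_lt.1 (Finset.mem_filter.1 hm).2)
    simpa using this
  have hEL : 8 * ∑ m ∈ Li, v m ≤ W * ∑ m ∈ Li, E m := by
    rw [Finset.mul_sum, Finset.mul_sum]
    exact Finset.sum_le_sum fun m hm => eight_mul_le_of_light (hLimem m hm) (hlight m (hLimem m hm))
  have hvL : 4 * ∑ m ∈ Li, v m ≤ #Li * a := by
    rw [Finset.mul_sum]
    have := Finset.sum_le_card_nsmul Li (fun m => 4 * v m) a
      (fun m hm => four_mul_le_of_light hWa (hLimem m hm) (hlight m (hLimem m hm)))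
    simpa using this
  obtain ⟨m₁, hm₁⟩ := hex
  have hu4 := four_mul_le_of_light hWa hm₁ (hlight m₁ hm₁)
  have hKLpos : 0 < K * L := by nlinarith
  have hapos : 0 < a := by omega
  have hzpos : 0 < z := Fintype.card_pos_iff.2 ⟨m₁⟩
  -- Light floors are at most a quarter full, so they alone cannot hold 49% of the volume.
  have hHne : Hv.Nonempty := by
    rw [Finset.nonempty_iff_ne_empty]
    intro h0
    rw [h0] at hcard hsumv
    simp only [Finset.card_empty, Finset.sum_empty, add_zero] at hcard hsumv
    rw [hcard, hsumv] at hvL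
    nlinarith [Nat.mul_pos hapos hzpos]
  obtain ⟨m₂, hm₂, hmax⟩ := Finset.exists_max_image Hv v hHne
  have hvH : ∑ m ∈ Hv, v m ≤ #Hv * v m₂ := by
    have := Finset.sum_le_card_nsmul Hv v (v m₂) hmax
    simpa using this
  have hP := hPil m₂ m₁
  have hWpos : 0 < W := by
    by_contra h0
    have : W = 0 := by omega
    subst this
    omega
  have hSA : ∑ m ∈ Li, v m ≤ N := by omega
  have ha' : (0 : ℝ) < a := by exact_mod_cast hapos
  have hz' : (0 : ℝ) < z := by exact_mod_cast hzpos
  have hW' : (0 : ℝ) < W := by exact_mod_cast hWpos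
  have hK' : (2829 : ℝ) ≤ K := by exact_mod_cast hK
  have hL' : (K : ℝ) ≤ L := by exact_mod_cast hKL
  set sA : ℕ := ∑ m ∈ Li, v m
  set eL : ℕ := ∑ m ∈ Li, E m
  set eH : ℕ := ∑ m ∈ Hv, E m
  set sH : ℕ := ∑ m ∈ Hv, v m
  have r1 : (2 * W : ℝ) * #Hv ≤ eH := by exact_mod_cast (mul_comm (2 * W) #Hv).le.trans hEH
  have r2 : (8 : ℝ) * sA ≤ W * eL := by exact_mod_cast hEL
  have r3 : (eL : ℝ) + eH + Pil ≤ 2 * (K * L) + 2 * K + 2 := by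
    exact_mod_cast (by omega : eL + eH + Pil ≤ 2 * (K * L) + 2 * K + 2)
  have r4 : (2 : ℝ) * v m₂ ≤ Pil + 2 * v m₁ := by exact_mod_cast hP
  have r5 : (4 : ℝ) * v m₁ ≤ a := by exact_mod_cast hu4
  have r6 : (N : ℝ) ≤ sA + #Hv * v m₂ := by exact_mod_cast (by omega : N ≤ sA + #Hv * v m₂)
  have r7 : (49 : ℝ) * (a * z) ≤ 100 * N := by exact_mod_cast hN1
  have r8 : (4 : ℝ) * sA ≤ #Li * a := by exact_mod_cast hvL
  have r9 : (#Li : ℝ) + #Hv = z := by exact_mod_cast hcard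
  have r10 : (W : ℝ) ^ 2 ≤ a := by exact_mod_cast hWa
  have r11 : (K : ℝ) * L ≤ W * z := by exact_mod_cast hWz
  have r12 : (K : ℝ) * L ≤ a := by exact_mod_cast hKLa
  exact one_sided_real_count ha' hz' hW' hK' hL' (Nat.cast_nonneg _) (Nat.cast_nonneg _)
    (Nat.cast_nonneg _) (Nat.cast_nonneg _) (Nat.cast_nonneg _)
    r1 r2 r3 r4 r5 r6 r7 r8 r9 r10 r11 r12

end Arithmetic

end Potts3D

namespace Potts3D

/-! ### Volume and energy balance with both kinds of light floors -/

section ArithmeticTwoSided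

open Finset

theorem two_sided_real_count {K L W a z nH nA nB sA sB eA eB eH Pil N u w : ℝ}
    (ha' : 0 < a) (hz' : 0 < z) (hW' : 0 < W) (hK' : 2829 ≤ K) (hL' : K ≤ L)
    (hnH : 0 ≤ nH) (hsA : 0 ≤ sA) (hsB : 0 ≤ sB) (heA : 0 ≤ eA) (heB : 0 ≤ eB)
    (hu : 0 ≤ u) (hw : 0 ≤ w)
    (r1 : 2 * W * nH ≤ eH) (r2 : 8 * sA ≤ W * eA) (r2' : 8 * sB ≤ W * eB)
    (r3 : eA + eB + eH + Pil ≤ 2 * (K * L) + 2 * K + 2)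
    (r4 : 2 * (a - u - w) ≤ Pil) (r5 : 4 * u ≤ a) (r5' : 4 * w ≤ a)
    (r6 : nA * u ≤ sA) (r6' : nB * w ≤ sB)
    (r7 : N ≤ (nB + nH) * a + sA) (r7' : a * z - N ≤ (nA + nH) * a + sB)
    (r8 : 49 * (a * z) ≤ 100 * N) (r8' : 100 * N ≤ 51 * (a * z))
    (r9 : nA + nB + nH = z) (r10 : W ^ 2 ≤ a)
    (r11 : K * L ≤ W * z) (r12 : K * L ≤ a) :
    3 * z ≤ 10 * nA ∧ 3 * z ≤ 10 * nB ∧ u + w ≤ 6 * K := by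
  have hKL' : 0 < K * L := by nlinarith
  have hKL2 : 2829 * K ≤ K * L := by nlinarith
  have share : ∀ s e : ℝ, 0 ≤ e → 8 * s ≤ W * e → 8 * (W * z) * (s / (a * z)) ≤ e := by
    intro s e he hse
    have : 8 * (W * z) * (s / (a * z)) = W * (8 * s) / a := by field_simp
    rw [this, div_le_iff₀ ha']
    calc W * (8 * s) ≤ W * (W * e) := by gcongr
      _ = e * W ^ 2 := by ring
      _ ≤ e * a := by gcongr
  have q1 := share sA eA heA r2
  have q1' := share sB eB heB r2'
  have q2 : 2 * (W * z) * (nH / z) ≤ eH := by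
    have : 2 * (W * z) * (nH / z) = 2 * W * nH := by field_simp
    linarith
  have q3 : 2 * a * (1 - u / a - w / a) ≤ Pil := by
    have : 2 * a * (1 - u / a - w / a) = 2 * (a - u - w) := by field_simp
    linarith
  have hu4 : u / a ≤ 1 / 4 := by rw [div_le_iff₀ ha']; linarith
  have hw4 : w / a ≤ 1 / 4 := by rw [div_le_iff₀ ha']; linarith
  have hε : (K + 1) / (K * L) ≤ 1 / 1000 := by rw [div_le_iff₀ hKL']; linarith
  have hE : nH / z + 4 * (sA / (a * z)) + 4 * (sB / (a * z)) - u / a - w / a ≤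
      (K + 1) / (K * L) := by
    have p1 : 2 * (K * L) * (nH / z + 4 * (sA / (a * z)) + 4 * (sB / (a * z))) ≤
        2 * (W * z) * (nH / z + 4 * (sA / (a * z)) + 4 * (sB / (a * z))) := by gcongr
    have hnn : 0 ≤ 1 - u / a - w / a := by linarith
    have p2 : 2 * (K * L) * (1 - u / a - w / a) ≤ 2 * a * (1 - u / a - w / a) := by gcongr
    rw [le_div_iff₀ hKL']
    linarith
  obtain ⟨hA, hB, huw⟩ := two_sided_real (A := nA / z) (B := nB / z) (h := nH / z)
    (s := sA / (a * z)) (t := sB / (a * z)) (u := u / a) (w := w / a) (ε := (K + 1) / (K * L))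
    (by rw [← add_div, ← add_div, r9, div_self hz'.ne']) (by positivity) (by positivity) hu4
    (by rw [div_mul_div_comm, mul_comm z a]; gcongr) (by positivity) hw4
    (by rw [div_mul_div_comm, mul_comm z a]; gcongr)
    (by
      have : nB / z + nH / z + sA / (a * z) = ((nB + nH) * a + sA) / (a * z) := by field_simp
      rw [this, le_div_iff₀ (by positivity)]; linarith)
    (by
      have : nA / z + nH / z + sB / (a * z) = ((nA + nH) * a + sB) / (a * z) := by field_simp
      rw [this, le_div_iff₀ (by positivity)]; linarith)
    hE hε
  refine ⟨?_, ?_, ?_⟩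
  · rw [le_div_iff₀ hz'] at hA; linarith
  · rw [le_div_iff₀ hz'] at hB; linarith
  -- A first bound u + w ≤ a/200 and the pillar energy give a ≤ 1.01 KL; then 5ε becomes 5.05 (K +
  -- 1) ≤ 6K.
  · have h1 : u + w = a * (u / a + w / a) := by field_simp
    have h2 : u / a + w / a ≤ 5 / 1000 := by linarith
    have h3 : u + w ≤ a * (5 / 1000) := by rw [h1]; gcongr
    have hP : Pil ≤ 2 * (K * L) + 2 * K + 2 := by
      have : 0 ≤ 2 * W * nH := by positivity
      linarith
    have h4 : a ≤ 1.01 * (K * L) := by linarith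
    have h5 : u + w ≤ 1.01 * (K * L) * (5 * ((K + 1) / (K * L))) := by
      rw [h1]
      have : 0 ≤ u / a + w / a := by positivity
      gcongr
    have h6 : 1.01 * (K * L) * (5 * ((K + 1) / (K * L))) = 5.05 * (K + 1) := by
      have : K * L * ((K + 1) / (K * L)) = K + 1 := mul_div_cancel₀ _ hKL'.ne'
      linear_combination 5.05 * this
    linarith

variable {ι : Type*}

theorem sum_light_le {s : Finset ι} {E x : ι → ℕ} (hx : ∀ m ∈ s, 16 * x m ≤ E m ^ 2) :
    16 * ∑ m ∈ s, x m ≤ (∑ m ∈ s, E m) ^ 2 := by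
  rw [Finset.mul_sum]
  exact (Finset.sum_le_sum hx).trans (Finset.sum_sq_le_sq_sum_of_nonneg fun _ _ => Nat.zero_le _)

/-- If every floor of a large family misses at least `u` sites, `u` is small. -/
theorem exists_small_energy {A : Finset ι} {E x : ι → ℕ} {K u T : ℕ} (hA : 3 * K ≤ 10 * #A)
    (hK : 0 < K) (hu : ∀ m ∈ A, u ≤ x m) (hx : ∀ m ∈ A, 16 * x m ≤ E m ^ 2)
    (hT : ∑ m ∈ A, E m ≤ T) : ∃ e, 3 * K * e ≤ 10 * T ∧ 16 * u ≤ e ^ 2 := by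
  have hne : A.Nonempty := Finset.card_pos.1 (by omega)
  obtain ⟨m, hm, hmin⟩ := Finset.exists_min_image A E hne
  have h1 := Finset.card_nsmul_le_sum A E (E m) hmin
  rw [smul_eq_mul] at h1
  refine ⟨E m, ?_, (Nat.mul_le_mul_left 16 (hu m hm)).trans (hx m hm)⟩
  calc 3 * K * E m ≤ 10 * #A * E m := Nat.mul_le_mul_right _ hA
    _ = 10 * (#A * E m) := by ring
    _ ≤ 10 * T := Nat.mul_le_mul_left 10 (h1.trans hT)

/-- Integrality of the energy `e` is what makes the later bootstrap gain. -/
theorem small_of_energy {K T e u k : ℕ} (h1 : 3 * K * e ≤ 10 * T) (h2 : 16 * u ≤ e ^ 2)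
    (hT : 10 * T < 3 * K * (k + 1)) : 16 * u ≤ k ^ 2 := by
  have : e < k + 1 := Nat.lt_of_mul_lt_mul_left (h1.trans_lt hT)
  exact h2.trans (Nat.pow_le_pow_left (by omega) 2)

variable [Fintype ι]

/-- The possible distributions of volume and energy among the floors of a configuration whose
energy does not exceed the barrier. -/
theorem floors_cases {E v : ι → ℕ} {Pil K L W a N : ℕ} (hK : 2829 ≤ K) (hKL : K ≤ L)
    (hKW : K ≤ W) (hKz : K ≤ Fintype.card ι)
    (hWa : W ^ 2 ≤ a) (hKLa : K * L ≤ a) (hWz : K * L ≤ W * Fintype.card ι)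
    (hva : ∀ m, v m ≤ a)
    (hlight : ∀ m, E m < 2 * W → 16 * v m ≤ E m ^ 2 ∨ 16 * (a - v m) ≤ E m ^ 2)
    (hPil : ∀ m m', 2 * v m ≤ Pil + 2 * v m') (hN : ∑ m, v m = N)
    (hN1 : 49 * (a * Fintype.card ι) ≤ 100 * N) (hN2 : 100 * N ≤ 51 * (a * Fintype.card ι))
    (hH : ∑ m, E m + Pil ≤ 2 * (K * L) + 2 * K + 2)
    (hvol : (a = K * L ∧ ∃ p r, N = p * a + r ∧ (K + 7) ^ 2 < 4 * r ∧
        (K + 7) ^ 2 + 4 * r < 4 * a) ∨ (K * L + K ≤ a ∧ ¬ a ∣ N)) :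
    (∀ m, 2 * W ≤ E m) ∨ (a = K * L ∧ 2 * a ≤ Pil ∧ ∃ m₀, 2 * W ≤ E m₀ ∧
      ∀ m, m ≠ m₀ → E m ≤ 2 ∧ (v m = 0 ∨ v m = a)) := by
  by_cases hheavy : ∀ m, 2 * W ≤ E m
  · exact Or.inl hheavy
  right
  push Not at hheavy
  set z := Fintype.card ι with hz
  have hKLpos : 0 < K * L := by nlinarith
  have hapos : 0 < a := by omega
  have hzpos : 0 < z := by omega
  have hWpos : 0 < W := by omega
  set Hv : Finset ι := {m | ¬ E m < 2 * W} with hHv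
  set A : Finset ι := {m | E m < 2 * W ∧ 16 * v m ≤ E m ^ 2} with hA
  set B : Finset ι := {m | E m < 2 * W ∧ ¬ 16 * v m ≤ E m ^ 2} with hB
  have hAm : ∀ m ∈ A, E m < 2 * W ∧ 16 * v m ≤ E m ^ 2 := fun m hm => (Finset.mem_filter.1 hm).2
  have hBm : ∀ m ∈ B, E m < 2 * W ∧ 16 * (a - v m) ≤ E m ^ 2 := fun m hm => by
    obtain ⟨h1, h2⟩ := (Finset.mem_filter.1 hm).2
    exact ⟨h1, (hlight m h1).resolve_left h2⟩
  have hAne : A.Nonempty := by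
    by_contra hc
    rw [Finset.not_nonempty_iff_eq_empty, Finset.filter_eq_empty_iff] at hc
    have hsum : ∑ m, (a - v m) = a * z - N := by
      have h1 : ∑ m, (a - v m) + ∑ m, v m = a * z := by
        rw [← Finset.sum_add_distrib, Finset.sum_congr rfl (fun m _ => Nat.sub_add_cancel (hva m))]
        simp [hz, mul_comm]
      omega
    -- Passing to the complement of `B` replaces `v` by `a - v`.
    refine one_sided_false (v := fun m => a - v m) (E := E) (Pil := Pil) hK hKL hWa hKLa hWz ?_ hsum
      ?_ hH ?_ hheavy
    · intro m m'
      have := hPil m' m; have := hva m; have := hva m'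
      show 2 * (a - v m) ≤ Pil + 2 * (a - v m')
      omega
    · rw [← hz]; omega
    · intro m hm
      exact (hlight m hm).resolve_left fun h => hc (Finset.mem_univ m) ⟨hm, h⟩
  have hBne : B.Nonempty := by
    by_contra hc
    rw [Finset.not_nonempty_iff_eq_empty, Finset.filter_eq_empty_iff] at hc
    refine one_sided_false (v := v) (E := E) (Pil := Pil) hK hKL hWa hKLa hWz hPil hN
      hN1 hH ?_ hheavy
    intro m hm
    by_contra h
    exact hc (Finset.mem_univ m) ⟨hm, h⟩
  have split : ∀ g : ι → ℕ, ∑ m ∈ A, g m + ∑ m ∈ B, g m + ∑ m ∈ Hv, g m = ∑ m, g m := by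
    intro g
    rw [← Finset.sum_filter_add_sum_filter_not univ (fun m => E m < 2 * W) g,
      ← Finset.sum_filter_add_sum_filter_not (Finset.filter (fun m => E m < 2 * W) univ)
        (fun m => 16 * v m ≤ E m ^ 2) g, Finset.filter_filter, Finset.filter_filter]
  have hcard : #A + #B + #Hv = z := by
    have := split (fun _ => 1)
    simpa using this
  obtain ⟨mA, hmA, hminA⟩ := Finset.exists_min_image A v hAne
  obtain ⟨mB, hmB, hminB⟩ := Finset.exists_min_image B (fun m => a - v m) hBne
  set u := v mA with hu
  set w := a - v mB with hw
  have hEH : #Hv * (2 * W) ≤ ∑ m ∈ Hv, E m := by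
    have := Finset.card_nsmul_le_sum Hv E (2 * W)
      (fun m hm => not_lt.1 (Finset.mem_filter.1 hm).2)
    simpa using this
  have hEA : 8 * ∑ m ∈ A, v m ≤ W * ∑ m ∈ A, E m := by
    rw [Finset.mul_sum, Finset.mul_sum]
    exact Finset.sum_le_sum fun m hm => eight_mul_le_of_light (hAm m hm).1 (hAm m hm).2
  have hEB : 8 * ∑ m ∈ B, (a - v m) ≤ W * ∑ m ∈ B, E m := by
    rw [Finset.mul_sum, Finset.mul_sum]
    exact Finset.sum_le_sum fun m hm => eight_mul_le_of_light (hBm m hm).1 (hBm m hm).2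
  have hu4 := four_mul_le_of_light hWa (hAm mA hmA).1 (hAm mA hmA).2
  have hw4 := four_mul_le_of_light hWa (hBm mB hmB).1 (hBm mB hmB).2
  have hnA : #A * u ≤ ∑ m ∈ A, v m := by
    simpa using Finset.card_nsmul_le_sum A v u hminA
  have hnB : #B * w ≤ ∑ m ∈ B, (a - v m) := by
    simpa using Finset.card_nsmul_le_sum B (fun m => a - v m) w hminB
  have hBsum : ∑ m ∈ B, v m + ∑ m ∈ B, (a - v m) = #B * a := by
    rw [← Finset.sum_add_distrib, Finset.sum_congr rfl (fun m _ => Nat.add_sub_cancel' (hva m))]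
    simp
  have hAsum : ∑ m ∈ A, v m ≤ #A * a := by
    simpa using Finset.sum_le_card_nsmul A v a (fun m _ => hva m)
  have hHsum : ∑ m ∈ Hv, v m ≤ #Hv * a := by
    simpa using Finset.sum_le_card_nsmul Hv v a (fun m _ => hva m)
  have hsplitv := split v
  have hsplitE := split E
  -- Compares the fullest of the nearly full floors with the emptiest of the nearly empty ones.
  have hPP : 2 * (a - u - w) ≤ Pil := by
    have := hPil mB mA; have := hva mB; omega
  have hzz : a * z = #A * a + #B * a + #Hv * a := by rw [← hcard]; ring
  obtain ⟨h3A, h3B, huw⟩ : 3 * z ≤ 10 * #A ∧ 3 * z ≤ 10 * #B ∧ u + w ≤ 6 * K := by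
    have key := two_sided_real_count (K := K) (L := L) (W := W) (a := a) (z := z) (nH := #Hv)
      (nA := #A) (nB := #B) (sA := (∑ m ∈ A, v m : ℕ)) (sB := (∑ m ∈ B, (a - v m) : ℕ))
      (eA := (∑ m ∈ A, E m : ℕ)) (eB := (∑ m ∈ B, E m : ℕ)) (eH := (∑ m ∈ Hv, E m : ℕ))
      (Pil := Pil) (N := N) (u := u) (w := w)
      (by exact_mod_cast hapos) (by exact_mod_cast hzpos) (by exact_mod_cast hWpos)
      (by exact_mod_cast hK) (by exact_mod_cast hKL) (Nat.cast_nonneg _) (Nat.cast_nonneg _)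
      (Nat.cast_nonneg _) (Nat.cast_nonneg _) (Nat.cast_nonneg _) (Nat.cast_nonneg _)
      (Nat.cast_nonneg _)
      (by exact_mod_cast (mul_comm (2 * W) #Hv).le.trans hEH) (by exact_mod_cast hEA)
      (by exact_mod_cast hEB) (by exact_mod_cast (by omega)) ?_ (by exact_mod_cast hu4)
      (by exact_mod_cast hw4) (by exact_mod_cast hnA) (by exact_mod_cast hnB) ?_ ?_
      (by exact_mod_cast hN1) (by exact_mod_cast hN2) (by exact_mod_cast hcard)
      (by exact_mod_cast hWa) (by exact_mod_cast hWz) (by exact_mod_cast hKLa)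
    · exact_mod_cast key
    · have h : 2 * a ≤ Pil + 2 * u + 2 * w := by omega
      have : (2 * a : ℝ) ≤ Pil + 2 * u + 2 * w := by exact_mod_cast h
      linarith
    · have h : N ≤ (#B + #Hv) * a + ∑ m ∈ A, v m := by rw [add_mul]; omega
      exact_mod_cast h
    · have h : a * z ≤ (#A + #Hv) * a + ∑ m ∈ B, (a - v m) + N := by rw [add_mul]; omega
      have : (a * z : ℝ) ≤ (#A + #Hv) * a + (∑ m ∈ B, (a - v m) : ℕ) + N := by exact_mod_cast h
      linarith
  have h3A' : 3 * K ≤ 10 * #A := by omega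
  have h3B' : 3 * K ≤ 10 * #B := by omega
  have hKpos : 0 < K := by omega
  have bound : ∀ T k : ℕ, ∑ m, E m ≤ T → 10 * T < 3 * K * (k + 1) →
      16 * u ≤ k ^ 2 ∧ 16 * w ≤ k ^ 2 := by
    intro T k hT hTk
    obtain ⟨e, he1, he2⟩ := exists_small_energy (T := T) h3A' hKpos hminA (fun m hm => (hAm m hm).2)
      (by omega)
    obtain ⟨e', he1', he2'⟩ := exists_small_energy (T := T) h3B' hKpos hminB
      (fun m hm => (hBm m hm).2) (by omega)
    exact ⟨small_of_energy he1 he2 hTk, small_of_energy he1' he2' hTk⟩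
  -- Bootstrap: the floor energy is at most 2K + 2 + 2(u + w). From u + w ≤ 6K this is 14K + 2; each
  -- kind has at least 3K/10 floors, so one of them has energy at most 46, and u, w ≤ 132. The floor
  -- energy is then at most 2K + 530, the smallest one at most 7 (as K > 1325), and u, w ≤ 3.
  obtain ⟨hu1, hw1⟩ := bound (14 * K + 2) 46 (by omega) (by omega)
  obtain ⟨hu2, hw2⟩ := bound (2 * K + 530) 7 (by omega) (by omega)
  have hEtot : ∑ m, E m + 2 * (a - K * L) ≤ 2 * K + 14 := by omega
  have zero_of : ∑ m ∈ A, E m + ∑ m ∈ B, E m ≤ 14 → u = 0 ∧ w = 0 := by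
    intro h14
    obtain ⟨e, he1, he2⟩ := exists_small_energy (T := 14) h3A' hKpos hminA
      (fun m hm => (hAm m hm).2) (by omega)
    obtain ⟨e', he1', he2'⟩ := exists_small_energy (T := 14) h3B' hKpos hminB
      (fun m hm => (hBm m hm).2) (by omega)
    have h1 := small_of_energy (k := 0) he1 he2 (by omega)
    have h2 := small_of_energy (k := 0) he1' he2' (by omega)
    omega
  have light_of : ∀ m, E m ≤ 2 → v m = 0 ∨ v m = a := by
    intro m hm
    have h4 : E m ^ 2 ≤ 2 ^ 2 := Nat.pow_le_pow_left hm 2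
    have := hva m
    rcases hlight m (by omega) with h | h
    · left; omega
    · right; omega
  rcases Hv.eq_empty_or_nonempty with h0 | ⟨m₀, hm₀⟩
  · exfalso
    rw [h0, Finset.sum_empty, add_zero] at hsplitv hsplitE
    rcases hvol with ⟨haKL, p, r, hNr, hr1, hr2⟩ | ⟨haKL, hdvd⟩
    · have hsA := sum_light_le (fun m hm => (hAm m hm).2)
      have hsB := sum_light_le (fun m hm => (hBm m hm).2)
      -- Without heavy floors, a total floor energy of 2(K + 7) keeps N within (K + 7)²/4 of the
      -- multiple `#B * a`; the remainder `r` was chosen farther from all multiples.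
      have hle : ∑ m ∈ A, E m + ∑ m ∈ B, E m ≤ 2 * (K + 7) := by omega
      have hsq : (∑ m ∈ A, E m) ^ 2 + (∑ m ∈ B, E m) ^ 2 ≤ (2 * (K + 7)) ^ 2 := by
        refine le_trans ?_ (Nat.pow_le_pow_left hle 2)
        rw [add_sq]; omega
      rw [mul_pow] at hsq
      rcases Nat.lt_or_ge p #B with hpB | hpB
      · have : (p + 1) * a ≤ #B * a := Nat.mul_le_mul_right a hpB
        rw [add_mul] at this
        omega
      · have : #B * a ≤ p * a := Nat.mul_le_mul_right a hpB
        omega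
    -- The excess area of at least K consumes 2K of the energy; what is left makes all floors empty
    -- or full, so `a` would divide `N`.
    · have hE14 : ∑ m, E m ≤ 14 := by omega
      obtain ⟨hu0, hw0⟩ := zero_of (by omega)
      have hE2 : ∑ m, E m ≤ 2 := by omega
      refine hdvd (hN ▸ Finset.dvd_sum fun m _ => ?_)
      rcases light_of m ((Finset.single_le_sum (fun _ _ => Nat.zero_le _)
        (Finset.mem_univ m)).trans hE2) with h | h <;> rw [h]
      exact dvd_zero a
  · have hm₀W : 2 * W ≤ E m₀ := not_lt.1 (Finset.mem_filter.1 hm₀).2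
    have hm₀H : E m₀ ≤ ∑ m ∈ Hv, E m :=
      Finset.single_le_sum (f := E) (fun _ _ => Nat.zero_le _) hm₀
    -- A heavy floor costs 2K and an excess area would cost another 2K, but only 2K + 14 is
    -- available.
    have haKL : a = K * L := by
      rcases hvol with h | h
      · exact h.1
      · omega
    obtain ⟨hu0, hw0⟩ := zero_of (by omega)
    refine ⟨haKL, by omega, m₀, hm₀W, fun m hm => ?_⟩
    classical
    have hpair : E m₀ + E m ≤ ∑ m, E m := by
      rw [← Finset.sum_pair (Ne.symm hm)]
      exact Finset.sum_le_sum_of_subset (Finset.subset_univ _)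
    have hm2 : E m ≤ 2 := by omega
    exact ⟨hm2, light_of m hm2⟩

end ArithmeticTwoSided

end Potts3D

namespace Potts3D

/-! ### Floors and pillars of three-dimensional configurations -/

section Cube

open Finset
open scoped Classical

variable {S : Type*} {X Y Z : ℕ} [NeZero X] [NeZero Y] [NeZero Z]

/-- The number of changes along the lines of the third direction. -/
noncomputable def pillarEnergy (f : ZMod X → ZMod Y → ZMod Z → S) : ℕ :=
  ∑ x, ∑ y, changes (f x y)

/-- The energy of a three-dimensional configuration: floors plus pillars. -/
noncomputable def cubeEnergy (f : ZMod X → ZMod Y → ZMod Z → S) : ℕ :=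
  ∑ z, planeEnergy (fun x y => f x y z) + pillarEnergy f

/-- The number of sites of a three-dimensional configuration whose spin lies in `B`. -/
noncomputable def cubeCount (B : Set S) (f : ZMod X → ZMod Y → ZMod Z → S) : ℕ :=
  ∑ z, siteCount B (fun x y => f x y z)

theorem cubeEnergy_eq (f : ZMod X → ZMod Y → ZMod Z → S) :
    cubeEnergy f = ∑ y, ∑ z, changes (fun x => f x y z) + ∑ x, ∑ z, changes (fun y => f x y z) +
      ∑ x, ∑ y, changes (fun z => f x y z) := by
  unfold cubeEnergy planeEnergy pillarEnergy
  rw [Finset.sum_add_distrib, Finset.sum_comm]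
  congr 2
  exact Finset.sum_comm

theorem cubeEnergy_swap₂₃ (f : ZMod X → ZMod Y → ZMod Z → S) :
    cubeEnergy (fun x z y => f x y z) = cubeEnergy f := by
  rw [cubeEnergy_eq, cubeEnergy_eq, Finset.sum_comm]
  ring

theorem cubeEnergy_swap₁₃ (f : ZMod X → ZMod Y → ZMod Z → S) :
    cubeEnergy (fun z y x => f x y z) = cubeEnergy f := by
  rw [cubeEnergy_eq, cubeEnergy_eq, Finset.sum_comm (s := (univ : Finset (ZMod Y))),
    Finset.sum_comm (s := (univ : Finset (ZMod Z))), Finset.sum_comm (s := (univ : Finset (ZMod Z)))]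
  ring

theorem siteCount_eq_sum (B : Set S) (g : ZMod X → ZMod Y → S) :
    siteCount B g = ∑ x, ∑ y, if g x y ∈ B then 1 else 0 := by
  unfold siteCount
  rw [Finset.card_filter, Fintype.sum_prod_type]

theorem cubeCount_swap₂₃ (B : Set S) (f : ZMod X → ZMod Y → ZMod Z → S) :
    cubeCount B (fun x z y => f x y z) = cubeCount B f := by
  unfold cubeCount
  simp only [siteCount_eq_sum]
  rw [Finset.sum_comm, Finset.sum_comm (s := (univ : Finset (ZMod Z)))]
  exact Finset.sum_congr rfl fun x _ => Finset.sum_comm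

theorem cubeCount_swap₁₃ (B : Set S) (f : ZMod X → ZMod Y → ZMod Z → S) :
    cubeCount B (fun z y x => f x y z) = cubeCount B f := by
  unfold cubeCount
  simp only [siteCount_eq_sum]
  rw [Finset.sum_comm]

theorem siteCount_le_mul (B : Set S) (g : ZMod X → ZMod Y → S) : siteCount B g ≤ X * Y := by
  have := siteCount_add_compl B g
  omega

theorem siteCount_le_card_ne {B : Set S} (g : ZMod X → ZMod Y → S) {s : S} (hs : s ∉ B) :
    siteCount B g ≤ #{p : ZMod X × ZMod Y | g p.1 p.2 ≠ s} :=
  Finset.card_le_card fun p hp => by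
    simp only [Finset.mem_filter, Finset.mem_univ, true_and] at hp ⊢
    exact fun h => hs (h ▸ hp)

theorem siteCount_const {B : Set S} {g : ZMod X → ZMod Y → S} {s : S} (hg : ∀ x y, g x y = s) :
    siteCount B g = if s ∈ B then X * Y else 0 := by
  unfold siteCount
  split_ifs with h <;> simp [hg, h, ZMod.card]

/-- A pillar in `B` at height `m` but not at `m'` is non-constant and costs 2. -/
theorem two_mul_siteCount_le (B : Set S) (f : ZMod X → ZMod Y → ZMod Z → S) (m m' : ZMod Z) :
    2 * siteCount B (fun x y => f x y m) ≤
      pillarEnergy f + 2 * siteCount B (fun x y => f x y m') := by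
  have h1 : 2 * #{p : ZMod X × ZMod Y | f p.1 p.2 m ∈ B ∧ f p.1 p.2 m' ∉ B} ≤
      ∑ p : ZMod X × ZMod Y, changes (f p.1 p.2) :=
    two_mul_card_le_sum_changes (g := fun p : ZMod X × ZMod Y => f p.1 p.2)
      (fun p : ZMod X × ZMod Y => f p.1 p.2 m ∈ B ∧ f p.1 p.2 m' ∉ B)
      (fun p hp => ⟨m, m', fun h => hp.2 (h ▸ hp.1)⟩)
  have h2 : ∑ p : ZMod X × ZMod Y, changes (f p.1 p.2) = pillarEnergy f :=
    Fintype.sum_prod_type _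
  have h3 : siteCount B (fun x y => f x y m) ≤
      #{p : ZMod X × ZMod Y | f p.1 p.2 m ∈ B ∧ f p.1 p.2 m' ∉ B} +
        siteCount B (fun x y => f x y m') := by
    unfold siteCount
    refine le_trans (Finset.card_le_card fun p hp => ?_) (Finset.card_union_le _ _)
    simp only [Finset.mem_filter, Finset.mem_univ, true_and, Finset.mem_union] at hp ⊢
    tauto
  omega

/-- `floors_cases` for the floors of a configuration on the torus. -/
theorem cube_floors_cases {f : ZMod X → ZMod Y → ZMod Z → S} {B : Set S} {K L W N : ℕ}
    (hK : 2829 ≤ K) (hKL : K ≤ L) (hKW : K ≤ W) (hKZ : K ≤ Z) (hWX : W ≤ X) (hWY : W ≤ Y)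
    (hKLa : K * L ≤ X * Y) (hWz : K * L ≤ W * Z) (hN : cubeCount B f = N)
    (hN1 : 49 * (X * Y * Z) ≤ 100 * N) (hN2 : 100 * N ≤ 51 * (X * Y * Z))
    (hH : cubeEnergy f ≤ 2 * (K * L) + 2 * K + 2)
    (hvol : (X * Y = K * L ∧ ∃ p r, N = p * (X * Y) + r ∧ (K + 7) ^ 2 < 4 * r ∧
        (K + 7) ^ 2 + 4 * r < 4 * (X * Y)) ∨ (K * L + K ≤ X * Y ∧ ¬ X * Y ∣ N)) :
    (∀ m, 2 * W ≤ planeEnergy (fun x y => f x y m)) ∨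
      (X * Y = K * L ∧ 2 * (X * Y) ≤ pillarEnergy f ∧
        ∃ m₀, 2 * W ≤ planeEnergy (fun x y => f x y m₀) ∧
          ∀ m, m ≠ m₀ → ∃ s, ∀ x y, f x y m = s) := by
  have hcross : ∀ m, planeEnergy (fun x y => f x y m) < 2 * W →
      ∃ s, 16 * #{p : ZMod X × ZMod Y | f p.1 p.2 m ≠ s} ≤
        planeEnergy (fun x y => f x y m) ^ 2 := fun m hm =>
    exists_cross_of_lt (f := fun x y => f x y m) (by omega) (by omega)
  have := floors_cases (E := fun m => planeEnergy (fun x y => f x y m))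
    (v := fun m => siteCount B (fun x y => f x y m)) (Pil := pillarEnergy f) (a := X * Y) (W := W)
    hK hKL hKW (by rwa [ZMod.card]) (by rw [sq]; exact Nat.mul_le_mul hWX hWY) hKLa
    (by rwa [ZMod.card]) (fun m => siteCount_le_mul B _) (fun m hm => by
      obtain ⟨s, hs⟩ := hcross m hm
      by_cases hsB : s ∈ B
      · right
        have h1 := siteCount_le_card_ne (B := Bᶜ) (fun x y => f x y m) (s := s) (by simpa using hsB)
        have h2 := siteCount_add_compl B (fun x y => f x y m)
        refine le_trans ?_ hs
        omega
      · left
        have h1 := siteCount_le_card_ne (B := B) (fun x y => f x y m) hsB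
        exact le_trans (Nat.mul_le_mul_left 16 h1) hs)
    (two_mul_siteCount_le B f) hN (by rwa [ZMod.card]) (by rwa [ZMod.card]) hH hvol
  rcases this with h | ⟨h1, h2, m₀, h3, h4⟩
  · exact Or.inl h
  · refine Or.inr ⟨h1, h2, m₀, h3, fun m hm => ?_⟩
    have hm2 : planeEnergy (fun x y => f x y m) ≤ 2 := (h4 m hm).1
    obtain ⟨s, hs⟩ := hcross m (by omega)
    have hsq : planeEnergy (fun x y => f x y m) ^ 2 ≤ 2 ^ 2 := Nat.pow_le_pow_left hm2 2
    have h0 : #{p : ZMod X × ZMod Y | f p.1 p.2 m ≠ s} = 0 := by omega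
    rw [Finset.card_eq_zero, Finset.filter_eq_empty_iff] at h0
    exact ⟨s, fun x y => not_not.1 (h0 (Finset.mem_univ (x, y)))⟩

theorem arc_succ {n : ℕ} (l : ZMod n) (v : ℕ) :
    arc l (v + 1) = insert (l + (v : ZMod n)) (arc l v) := by
  ext x
  simp only [arc, Set.mem_ofPred_eq, Set.mem_insert_iff]
  constructor
  · rintro ⟨j, hj, rfl⟩
    rcases Nat.lt_succ_iff_lt_or_eq.1 hj with h | rfl
    · exact Or.inr ⟨j, h, rfl⟩
    · exact Or.inl rfl
  · rintro (rfl | ⟨j, hj, rfl⟩)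
    · exact ⟨v, by omega, rfl⟩
    · exact ⟨j, by omega, rfl⟩

theorem arc_pred {n : ℕ} (l : ZMod n) (v : ℕ) :
    arc (l - 1) (v + 1) = insert (l - 1) (arc l v) := by
  ext x
  simp only [arc, Set.mem_ofPred_eq, Set.mem_insert_iff]
  constructor
  · rintro ⟨j, hj, rfl⟩
    rcases Nat.eq_zero_or_pos j with rfl | h
    · left; simp
    · right
      refine ⟨j - 1, by omega, ?_⟩
      rw [Nat.cast_sub h]; push_cast; ring
  · rintro (rfl | ⟨j, hj, rfl⟩)
    · exact ⟨0, by omega, by simp⟩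
    · exact ⟨j + 1, by omega, by push_cast; ring⟩

theorem arc_mem_connSets {n : ℕ} (hn : 2 ≤ n) (l : ZMod n) (v : ℕ) : arc l v ∈ connSets n := by
  have h1 : (1 : ZMod n) ≠ 0 := by
    have := natCast_ne_zero_of_lt (n := n) Nat.one_pos (by omega); simpa using this
  have key : ∀ (j : ℕ) (hj : j < v) (h0 : 0 < v), ((torus1 n).induce (arc l v)).Reachable
      ⟨l + ((0 : ℕ) : ZMod n), 0, h0, rfl⟩ ⟨l + (j : ZMod n), j, hj, rfl⟩ := by
    intro j
    induction j with
    | zero => intro _ _; exact SimpleGraph.Reachable.refl _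
    | succ j ih =>
      intro hj h0
      refine (ih (by omega) h0).trans (SimpleGraph.Adj.reachable ?_)
      simp only [SimpleGraph.comap_adj, Function.Embedding.subtype_apply, torus1,
        SimpleGraph.circulantGraph_adj, Set.mem_singleton_iff]
      push_cast
      refine ⟨?_, Or.inr (by ring)⟩
      intro h
      apply h1
      linear_combination -h
  rintro ⟨x, i, hi, rfl⟩ ⟨y, j, hj, rfl⟩
  exact (key i hi (by omega)).symm.trans (key j hj (by omega))

/-- A configuration of energy at most the barrier with a single non-constant floor of volume `r`
is a gateway configuration. -/
theorem stack_gateway {K L M : ℕ} [NeZero K] [NeZero L] [NeZero M] (hK : 3 ≤ K) (hKL : K ≤ L)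
    (hM : 3 ≤ M)
    {f : ZMod K → ZMod L → ZMod M → S} {B : Set S} {p r : ℕ} {m₀ : ZMod M}
    (hconst : ∀ m, m ≠ m₀ → ∃ s, ∀ x y, f x y m = s)
    (hcount : cubeCount B f = p * (K * L) + r)
    (hp1 : 1 ≤ p) (hp2 : p + 2 ≤ M) (hr1 : 3 * K ≤ r)
    (hr2 : r + 3 * K ≤ K * L) (hr3 : (K + 1) ^ 2 < 4 * r) (hr4 : (K + 1) ^ 2 + 4 * r < 4 * (K * L))
    (hdK : ¬ K ∣ r) (hdL : ¬ L ∣ r) (hpil : 2 * (K * L) ≤ pillarEnergy f)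
    (hm₀ : 2 * K ≤ planeEnergy (fun x y => f x y m₀)) :
    2 * (K * L) + 2 * K + 2 ≤ cubeEnergy f ∧ (cubeEnergy f ≤ 2 * (K * L) + 2 * K + 2 →
      ∃ a b, a ∉ B ∧ b ∈ B ∧ ∃ P ∈ connSets M, ∃ Q ∈ connSets M, P.ncard = p ∧ Prec P Q ∧
        (fun x : Site3 K L M => f x.1.1 x.1.2 x.2) ∈ preGateway a b P Q) := by
  set c : ZMod M → S := fun m => f 0 0 m with hc
  have hfc : ∀ m, m ≠ m₀ → ∀ x y, f x y m = c m := by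
    intro m hm x y
    obtain ⟨s, hs⟩ := hconst m hm
    rw [hs, hc]
    exact (hs 0 0).symm
  set n := #{m : ZMod M | m ≠ m₀ ∧ c m ∈ B} with hn
  have hvol : cubeCount B f = siteCount B (fun x y => f x y m₀) + n * (K * L) := by
    unfold cubeCount
    rw [← Finset.add_sum_erase _ _ (Finset.mem_univ m₀)]
    congr 1
    rw [Finset.sum_congr rfl (g := fun m => if c m ∈ B then K * L else 0) (fun m hm =>
      siteCount_const (hfc m (Finset.ne_of_mem_erase hm))), ← Finset.sum_filter, Finset.sum_const,
      smul_eq_mul, hn]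
    congr 2
    ext m
    simp
  have hle := siteCount_le_mul B (fun x y => f x y m₀)
  have hnp : n = p := by
    have hKL0 : r < K * L := by omega
    rcases lt_trichotomy n p with h | h | h
    · have : (n + 1) * (K * L) ≤ p * (K * L) := Nat.mul_le_mul_right _ h
      rw [add_mul] at this
      have : 0 < 3 * K := by omega
      omega
    · exact h
    · have : (p + 1) * (K * L) ≤ n * (K * L) := Nat.mul_le_mul_right _ h
      rw [add_mul] at this
      omega
  have hr : siteCount B (fun x y => f x y m₀) = r := by rw [hnp] at hvol; omega
  obtain ⟨hge, hgate⟩ := plane_gateway (f := fun x y => f x y m₀) hK hKL hr hr1 hr2 hr3 hr4 hdK hdL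
  have hfloor : planeEnergy (fun x y => f x y m₀) ≤ ∑ z, planeEnergy (fun x y => f x y z) :=
    Finset.single_le_sum (f := fun z => planeEnergy (fun x y => f x y z))
      (fun _ _ => Nat.zero_le _) (Finset.mem_univ m₀)
  refine ⟨by unfold cubeEnergy; omega, fun hH => ?_⟩
  unfold cubeEnergy at hH
  obtain ⟨a', b', ha', hb', hval, hbulk⟩ := hgate (by omega)
  have hcompl := siteCount_add_compl B (fun x y => f x y m₀)
  -- A slack of 2 suffices, as the floor `m₀` has far more than two sites on either side of `B`.
  have hsum : ∑ q : ZMod K × ZMod L, changes (f q.1 q.2) ≤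
      2 * Fintype.card (ZMod K × ZMod L) + 2 := by
    have hpe : ∑ q : ZMod K × ZMod L, changes (f q.1 q.2) = pillarEnergy f :=
      Fintype.sum_prod_type _
    rw [Fintype.card_prod, ZMod.card, ZMod.card, hpe]
    omega
  have hsmall : ∀ (C : Set S) (D : S → Prop) [DecidablePred D], (∀ s ∈ C, s = a' ∨ s = b' → D s) →
      siteCount C (fun x y => f x y m₀) ≤ #{q : ZMod K × ZMod L | D (f q.1 q.2 m₀)} := by
    intro C D _ hCD
    refine Finset.card_le_card fun q hq => ?_
    simp only [Finset.mem_filter, Finset.mem_univ, true_and] at hq ⊢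
    exact hCD _ hq (hval _ _)
  have ha'b : ∀ s, s = a' ∨ s = b' → (s ∈ B ↔ s = b') := by
    rintro s (rfl | rfl)
    · exact ⟨fun h => absurd h ha', fun h => h ▸ hb'⟩
    · simp [hb']
  rcases stack_cases (P := ZMod K × ZMod L) hM (F := fun q => f q.1 q.2) (c := c) (m₀ := m₀) (e := 2)
    (fun q m hm => hfc m hm q.1 q.2) hsum with ⟨a, ha⟩ | ⟨a, ha⟩ |
      ⟨a, b, hab, hcab, hcard, harca, harcb⟩
  · exfalso
    by_cases haB : a ∈ B
    · have := siteCount_le_card_ne (B := Bᶜ) (fun x y => f x y m₀) (s := a) (by simpa using haB)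
      omega
    · have := siteCount_le_card_ne (B := B) (fun x y => f x y m₀) haB
      omega
  -- Equal values on all other floors would give n = 0 or n = M - 1, against 1 ≤ p ≤ M - 2.
  · exfalso
    by_cases haB : a ∈ B
    · have : n = M - 1 := by
        rw [hn]
        have : ({m : ZMod M | m ≠ m₀ ∧ c m ∈ B} : Finset _) = univ.erase m₀ := by
          ext m
          simp only [Finset.mem_filter, Finset.mem_univ, true_and, Finset.mem_erase, and_true]
          exact ⟨fun h => h.1, fun h => ⟨h, by rw [ha m h]; exact haB⟩⟩
        rw [this, Finset.card_erase_of_mem (Finset.mem_univ _), Finset.card_univ, ZMod.card]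
      omega
    · have : n = 0 := by
        rw [hn, Finset.card_eq_zero, Finset.filter_eq_empty_iff]
        rintro m - ⟨h1, h2⟩
        exact haB (ha m h1 ▸ h2)
      omega
  -- If `b'` differed from both stack values, all `r` sites carrying it would be among the at most
  -- two exceptional ones.
  · have hb'ab : b' = a ∨ b' = b := by
      by_contra hcon
      push Not at hcon
      have := hsmall B (fun s => s ≠ a ∧ s ≠ b) (fun s hs hs' => by
        rw [(ha'b s hs').1 hs]; exact hcon)
      omega
    have ha'ab : a' = a ∨ a' = b := by
      by_contra hcon
      push Not at hcon
      have := hsmall Bᶜ (fun s => s ≠ a ∧ s ≠ b) (fun s hs hs' => by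
        rcases hs' with rfl | rfl
        · exact hcon
        · exact absurd hb' hs)
      omega
    have hne : a' ≠ b' := fun h => ha' (h ▸ hb')
    obtain ⟨l, v, hv, harc, hml⟩ : ∃ (l : ZMod M) (v : ℕ), v + 2 ≤ M ∧
        arc l v = {m | m ≠ m₀ ∧ c m = b'} ∧ (m₀ = l + (v : ZMod M) ∨ m₀ = l - 1) := by
      rcases hb'ab with rfl | rfl
      · exact harca
      · exact harcb
    have hcab' : ∀ m, m ≠ m₀ → c m = a' ∨ c m = b' := by
      intro m hm
      have := hcab m hm
      rcases hb'ab with rfl | rfl <;> rcases ha'ab with rfl | rfl <;> tauto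
    have hvp : v = p := by
      rw [← hnp, hn, ← ncard_arc l (show v ≤ M by omega), harc, ← Set.ncard_coe_finset]
      congr 1
      ext m
      simp only [Set.mem_ofPred_eq, Finset.coe_filter, Finset.mem_univ, true_and]
      exact ⟨fun h => ⟨h.1, h.2 ▸ hb'⟩, fun h => ⟨h.1, (ha'b _ (hcab' m h.1)).1 h.2⟩⟩
    obtain ⟨l', hQ⟩ : ∃ l', arc l' (v + 1) = insert m₀ (arc l v) := by
      rcases hml with rfl | rfl
      · exact ⟨l, arc_succ l v⟩
      · exact ⟨l - 1, arc_pred l v⟩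
    refine ⟨a', b', ha', hb', arc l v, arc_mem_connSets (by omega) l v, arc l' (v + 1),
      arc_mem_connSets (by omega) l' (v + 1), by rw [ncard_arc l (by omega), hvp],
      ⟨?_, ?_⟩, ?_, ?_, ?_⟩
    · rw [hQ]; exact Set.subset_insert _ _
    · rw [ncard_arc l (by omega), ncard_arc l' (by omega)]
    · intro m hm
      rw [harc] at hm
      funext x
      exact (hfc m hm.1 x.1 x.2).trans hm.2
    · intro m hm
      rw [hQ, Set.mem_insert_iff, not_or, harc] at hm
      funext x
      refine (hfc m hm.1 x.1 x.2).trans ((hcab' m hm.1).resolve_right fun h => hm.2 ⟨hm.1, h⟩)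
    · rintro m ⟨hm, hm'⟩
      rw [hQ, Set.mem_insert_iff] at hm
      rcases hm with rfl | hm
      · exact Or.inl (Or.inr (Or.inr hbulk))
      · exact absurd hm hm'

end Cube

end Potts3D

namespace Potts3D

/-! ### The critical volume and the threshold -/

section Volume

/-- A volume whose floors cannot be completed without a strip carrying an incomplete line. -/
theorem exists_volume {K L M : ℕ} (hK : 2829 ≤ K) (hKL : K ≤ L) (hLM : L ≤ M) :
    ∃ r, ¬ K ∣ r ∧ ¬ L ∣ r ∧ 3 * K ≤ r ∧ r + 3 * K ≤ K * L ∧ (K + 7) ^ 2 < 4 * r ∧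
      (K + 7) ^ 2 + 4 * r < 4 * (K * L) ∧
      49 * (K * L * M) ≤ 100 * (M / 2 * (K * L) + r) ∧
      100 * (M / 2 * (K * L) + r) ≤ 51 * (K * L * M) := by
  -- `L` cannot divide two consecutive integers, so a shift by 1 or 2 avoids its multiples; as 0 < s
  -- < K, it also avoids those of `K`.
  obtain ⟨s, hs1, hs2, hsL⟩ : ∃ s, 1 ≤ s ∧ s ≤ 2 ∧ ¬ L ∣ L / 2 * K + s := by
    by_cases h : L ∣ L / 2 * K + 1
    · refine ⟨2, by omega, le_rfl, fun h2 => ?_⟩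
      have := (Nat.dvd_add_right h).1 (show L ∣ L / 2 * K + 1 + 1 by simpa using h2)
      have := Nat.le_of_dvd one_pos this
      omega
    · exact ⟨1, le_rfl, by omega, h⟩
  have hq1 : L ≤ 2 * (L / 2) + 1 := by omega
  have hq2 : 2 * (L / 2) ≤ L := by omega
  have hp1 : M ≤ 2 * (M / 2) + 1 := by omega
  have hp2 : 2 * (M / 2) ≤ M := by omega
  generalize L / 2 = q at *
  generalize M / 2 = p at *
  have e1 : K * L ≤ 2 * (q * K) + K := by nlinarith
  have e2 : 2 * (q * K) ≤ K * L := by nlinarith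
  have e3 : K * K ≤ K * L := Nat.mul_le_mul_left K hKL
  have e4 : 2829 * K ≤ K * K := Nat.mul_le_mul_right K hK
  have e5 : 2829 * (K * L) ≤ K * L * M := by nlinarith
  have e6 : K * L * M ≤ 2 * (p * (K * L)) + K * L := by
    have := Nat.mul_le_mul_left (K * L) hp1
    linarith
  have e7 : 2 * (p * (K * L)) ≤ K * L * M := by
    have := Nat.mul_le_mul_left (K * L) hp2
    linarith
  have e8 : (K + 7) ^ 2 = K * K + 14 * K + 49 := by ring
  refine ⟨q * K + s, fun h => ?_, hsL, ?_, ?_, ?_, ?_, ?_, ?_⟩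
  · have := (Nat.dvd_add_right (Dvd.intro_left q rfl)).1 h
    have := Nat.le_of_dvd (by omega) this
    omega
  all_goals omega

/-- Places the level ⌊M/2⌋ inside the range allowed in `gateway`. -/
theorem mK_le {K : ℕ} (hK : 64 ≤ K) : 4 * mK K ≤ K := by
  have hK' : (64 : ℝ) ≤ K := by exact_mod_cast hK
  have h4 : (4 : ℝ) ≤ (K : ℝ) ^ ((1 : ℝ) / 3) := by
    have : (4 : ℝ) = (64 : ℝ) ^ ((1 : ℝ) / 3) := by
      rw [show (64 : ℝ) = 4 ^ (3 : ℝ) by norm_num, ← Real.rpow_mul (by norm_num)]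
      norm_num
    rw [this]
    exact Real.rpow_le_rpow (by norm_num) hK' (by norm_num)
  have hmul : (K : ℝ) ^ ((2 : ℝ) / 3) * (K : ℝ) ^ ((1 : ℝ) / 3) = K := by
    rw [← Real.rpow_add (by linarith)]; norm_num
  have hpos : (0 : ℝ) ≤ (K : ℝ) ^ ((2 : ℝ) / 3) := by positivity
  have hfl : (mK K : ℝ) ≤ (K : ℝ) ^ ((2 : ℝ) / 3) := Nat.floor_le hpos
  have : (4 : ℝ) * mK K ≤ K := by nlinarith
  exact_mod_cast this

end Volume

/-! ### Configurations of the critical volume -/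

section Gateway

open Finset
open scoped Classical

variable {S : Type*} {K L M : ℕ} [NeZero K] [NeZero L] [NeZero M]

/-- The spins of a configuration as a function of the three coordinates. -/
def curry3 (σ : Site3 K L M → S) : ZMod K → ZMod L → ZMod M → S := fun x y z => σ ((x, y), z)

/-- Each line lies in floors of two orientations, so the three totals of floor energies add up to
twice the energy; they are at least 2KM, 2KL and 2KL. -/
theorem not_all_heavy (hK : 3 ≤ K) (hKL : K ≤ L) (hLM : L ≤ M) {f : ZMod K → ZMod L → ZMod M → S}
    (h₃ : ∀ m, 2 * K ≤ planeEnergy (fun x y => f x y m))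
    (h₂ : ∀ m, 2 * K ≤ planeEnergy (fun x z => f x m z))
    (h₁ : ∀ m, 2 * L ≤ planeEnergy (fun z y => f m y z)) :
    2 * (K * L) + 2 * K + 2 < cubeEnergy f := by
  have sum_ge : ∀ {n : ℕ} [NeZero n] {g : ZMod n → ℕ} {w : ℕ}, (∀ m, w ≤ g m) →
      n * w ≤ ∑ m, g m := by
    intro n _ g w hg
    simpa [ZMod.card] using Finset.card_nsmul_le_sum univ g w (fun m _ => hg m)
  have s₃ := sum_ge h₃
  have s₂ := sum_ge h₂
  have s₁ := sum_ge h₁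
  have e₂ := cubeEnergy_swap₂₃ f
  have e₁ := cubeEnergy_swap₁₃ f
  have e := cubeEnergy_eq f
  have e₃ : cubeEnergy f = ∑ z, planeEnergy (fun x y => f x y z) + pillarEnergy f := rfl
  have p₁ : pillarEnergy (fun z y x => f x y z) = ∑ y, ∑ z, changes (fun x => f x y z) :=
    Finset.sum_comm
  have p₂ : pillarEnergy (fun x z y => f x y z) = ∑ x, ∑ z, changes (fun y => f x y z) := rfl
  have p₃ : pillarEnergy f = ∑ x, ∑ y, changes (fun z => f x y z) := rfl
  rw [cubeEnergy] at e₁ e₂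
  have t1 : L * (2 * K) = 2 * (K * L) := by ring
  have t2 : K * (2 * L) = 2 * (K * L) := by ring
  have t3 : K * L ≤ M * K := by rw [mul_comm]; exact Nat.mul_le_mul_right K hLM
  have t4 : M * (2 * K) = 2 * (M * K) := by ring
  have t5 : 3 * K ≤ K * L := by rw [mul_comm]; exact Nat.mul_le_mul_left K (hK.trans hKL)
  omega

/-- Configurations of the critical volume reach the barrier, and those that do not exceed it are
gateway configurations. -/
theorem gateway_of_cubeCount (hK : 2829 ≤ K) (hKL : K ≤ L) (hLM : L ≤ M) {B : Set S} {r : ℕ}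
    (hdK : ¬ K ∣ r) (hdL : ¬ L ∣ r) (hr1 : 3 * K ≤ r)
    (hr2 : r + 3 * K ≤ K * L) (hr3 : (K + 7) ^ 2 < 4 * r) (hr4 : (K + 7) ^ 2 + 4 * r < 4 * (K * L))
    (hN1 : 49 * (K * L * M) ≤ 100 * (M / 2 * (K * L) + r))
    (hN2 : 100 * (M / 2 * (K * L) + r) ≤ 51 * (K * L * M))
    {σ : Site3 K L M → S} (hcount : cubeCount B (curry3 σ) = M / 2 * (K * L) + r) :
    Gamma K L ≤ cubeEnergy (curry3 σ) ∧ (cubeEnergy (curry3 σ) ≤ Gamma K L →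
      ∃ a b, a ∉ B ∧ b ∈ B ∧ σ ∈ gateway K L M a b) := by
  have hΓ : Gamma K L = 2 * (K * L) + 2 * K + 2 := by unfold Gamma; ring
  by_cases hE : cubeEnergy (curry3 σ) ≤ 2 * (K * L) + 2 * K + 2
  swap
  · exact ⟨by omega, fun h => by omega⟩
  have hm := mK_le (show 64 ≤ K by omega)
  have hr3' : (K + 1) ^ 2 < 4 * r := (Nat.pow_le_pow_left (by omega) 2).trans_lt hr3
  have hr4' : (K + 1) ^ 2 + 4 * r < 4 * (K * L) :=
    (Nat.add_le_add_right (Nat.pow_le_pow_left (by omega) 2) _).trans_lt hr4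
  have hdKN : ¬ K ∣ M / 2 * (K * L) + r := fun h =>
    hdK ((Nat.dvd_add_right (Dvd.dvd.mul_left (Dvd.intro L rfl) _)).1 h)
  have hdLN : ¬ L ∣ M / 2 * (K * L) + r := fun h =>
    hdL ((Nat.dvd_add_right (Dvd.dvd.mul_left (Dvd.intro_left K rfl) _)).1 h)
  rcases cube_floors_cases (f := curry3 σ) (W := K) (B := B) hK hKL le_rfl (hKL.trans hLM) le_rfl
    hKL le_rfl (Nat.mul_le_mul_left K hLM) hcount hN1 hN2 hE
    (Or.inl ⟨rfl, _, _, rfl, hr3, hr4⟩) with h₃ | ⟨-, hpil, m₀, hm₀, hconst⟩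
  swap
  · obtain ⟨hge, hgate⟩ := stack_gateway (by omega) hKL (by omega) hconst hcount (by omega)
      (by omega) hr1 hr2 hr3' hr4' hdK hdL hpil hm₀
    refine ⟨hΓ ▸ hge, fun _ => ?_⟩
    obtain ⟨a, b, ha, hb, P, hP, Q, hQ, hcard, hPQ, hmem⟩ := hgate hE
    exact ⟨a, b, ha, hb, M / 2, by omega, by omega, P, hP, Q, hQ, hcard, hPQ, Or.inl hmem⟩
  have hE₂ := (cubeEnergy_swap₂₃ (curry3 σ)).le.trans hE
  have hcount₂ := (cubeCount_swap₂₃ B (curry3 σ)).trans hcount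
  -- The floors are now K × M. For L < M their area exceeds KL by at least K, and KM does not divide
  -- the volume because K does not; only heavy floors remain possible. For L = M the previous
  -- argument applies after a swap.
  rcases cube_floors_cases (f := fun x z y => curry3 σ x y z) (W := K) (B := B) hK hKL le_rfl hKL
    le_rfl (hKL.trans hLM) (Nat.mul_le_mul_left K hLM) le_rfl hcount₂
    (by rwa [mul_right_comm]) (by rwa [mul_right_comm K M L]) hE₂
    (by
      rcases hLM.eq_or_lt with rfl | hlt
      · exact Or.inl ⟨rfl, _, _, rfl, hr3, hr4⟩
      · exact Or.inr ⟨by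
          have := Nat.mul_le_mul_left K (Nat.succ_le_of_lt hlt)
          rwa [Nat.succ_eq_add_one, mul_add, mul_one] at this,
          fun h => hdKN (dvd_of_mul_right_dvd h)⟩) with h₂ | ⟨hKM, hpil, m₀, hm₀, hconst⟩
  swap
  · obtain rfl : M = L := Nat.eq_of_mul_eq_mul_left (by omega) hKM
    obtain ⟨hge, hgate⟩ := stack_gateway (by omega) hKL (by omega) hconst hcount₂ (by omega)
      (by omega) hr1 hr2 hr3' hr4' hdK hdL hpil hm₀
    rw [cubeEnergy_swap₂₃] at hge hgate
    refine ⟨hΓ ▸ hge, fun _ => ?_⟩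
    obtain ⟨a, b, ha, hb, P, hP, Q, hQ, hcard, hPQ, hmem⟩ := hgate hE
    refine ⟨a, b, ha, hb, M / 2, by omega, by omega, P, hP, Q, hQ, hcard, hPQ,
      Or.inr (Or.inr (Or.inl ⟨rfl, _, hmem, ?_⟩))⟩
    funext x
    simp [theta23, curry3, ZMod.ringEquivCongr_refl]
  have hE₁ := (cubeEnergy_swap₁₃ (curry3 σ)).le.trans hE
  have hcount₁ := (cubeCount_swap₁₃ B (curry3 σ)).trans hcount
  -- The floors are now M × L with shorter side `L`, so heavy means at least 2L. The single-floor
  -- alternative survives only for K = L = M.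
  rcases cube_floors_cases (f := fun z y x => curry3 σ x y z) (W := L) (B := B) hK hKL hKL le_rfl
    hLM le_rfl (Nat.mul_le_mul_right L (hKL.trans hLM)) (mul_comm K L).le hcount₁
    (by rwa [show M * L * K = K * L * M by ring]) (by rwa [show M * L * K = K * L * M by ring]) hE₁
    (by
      rcases (hKL.trans hLM).eq_or_lt with rfl | hlt
      · exact Or.inl ⟨rfl, _, _, rfl, hr3, hr4⟩
      · exact Or.inr ⟨by
          have := Nat.mul_le_mul_right L (Nat.succ_le_of_lt hlt)
          rw [Nat.succ_eq_add_one, add_mul, one_mul] at this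
          omega,
          fun h => hdLN (dvd_of_mul_left_dvd h)⟩) with h₁ | ⟨hML, hpil, m₀, hm₀, hconst⟩
  swap
  · obtain rfl : M = K := Nat.eq_of_mul_eq_mul_right (by omega) hML
    obtain rfl : M = L := le_antisymm hKL hLM
    obtain ⟨hge, hgate⟩ := stack_gateway (by omega) le_rfl (by omega) hconst hcount₁ (by omega)
      (by omega) hr1 hr2 hr3' hr4' hdK hdL hpil hm₀
    rw [cubeEnergy_swap₁₃] at hge hgate
    refine ⟨hΓ ▸ hge, fun _ => ?_⟩
    obtain ⟨a, b, ha, hb, P, hP, Q, hQ, hcard, hPQ, hmem⟩ := hgate hE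
    refine ⟨a, b, ha, hb, M / 2, by omega, by omega, P, hP, Q, hQ, hcard, hPQ,
      Or.inr (Or.inr (Or.inr ⟨rfl, rfl, _, hmem, Or.inl ?_⟩))⟩
    funext x
    simp [theta13, curry3, ZMod.ringEquivCongr_refl]
  exact absurd hE (not_le.2 (not_all_heavy (by omega) hKL hLM h₃ h₂ h₁))

end Gateway

/-! ### Comparison with the graph energy -/

section Energy

open Finset
open scoped Classical

variable {S : Type*}

theorem changes_eq_sum {n : ℕ} [NeZero n] (f : ZMod n → S) :
    changes f = ∑ i, if f i ≠ f (i + 1) then 1 else 0 := by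
  unfold changes
  exact Finset.card_filter _ _

/-- The energy is at least the number of disagreements along a family of independent steps. -/
theorem sum_card_le_energy {V D : Type*} [AddCommGroup V] [Fintype V] [Fintype D]
    (G : SimpleGraph V) (e : D → V) (hadj : ∀ d x, G.Adj x (x + e d))
    (hinj : Function.Injective e) (hadd : ∀ d d', e d + e d' ≠ 0) (σ : V → S) :
    ∑ d, #{x | σ x ≠ σ (x + e d)} ≤ energy G σ := by
  have hcard : ∑ d, #{x | σ x ≠ σ (x + e d)} = #{p : D × V | σ p.2 ≠ σ (p.2 + e p.1)} := by
    rw [Finset.card_filter, Fintype.sum_prod_type]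
    exact Finset.sum_congr rfl fun d _ => Finset.card_filter _ _
  rw [hcard, ← Set.ncard_coe_finset]
  refine Set.ncard_le_ncard_of_injOn (fun p => s(p.2, p.2 + e p.1)) ?_ ?_ (Set.toFinite _)
  · intro p hp
    simp only [Finset.coe_filter, Finset.mem_univ, true_and, Set.mem_ofPred_eq] at hp
    exact ⟨hadj _ _, by simpa using hp⟩
  · rintro ⟨d, x⟩ - ⟨d', x'⟩ - h
    simp only [Sym2.eq_iff] at h
    rcases h with ⟨rfl, h⟩ | ⟨h1, h2⟩
    · rw [hinj (add_left_cancel h)]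
    -- The same edge read from its two ends would need opposite steps.
    · exfalso
      apply hadd d d'
      have : x' + (e d' + e d) = x' + 0 := by
        rw [← add_assoc, ← h1, h2, add_zero]
      rw [add_comm]
      exact add_left_cancel this

theorem torus1_adj_add_one {n : ℕ} (hn : 2 ≤ n) (x : ZMod n) : (torus1 n).Adj x (x + 1) := by
  have h1 : (1 : ZMod n) ≠ 0 := by
    have := natCast_ne_zero_of_lt (n := n) Nat.one_pos (by omega); simpa using this
  simp [torus1, SimpleGraph.circulantGraph_adj, h1]

/-- Only this inequality is needed. Sides of length at least 3 keep 1 + 1 nonzero, so no edge is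
counted from both ends. -/
theorem cubeEnergy_le_energy {K L M : ℕ} [NeZero K] [NeZero L] [NeZero M] (hK : 3 ≤ K) (hL : 3 ≤ L)
    (hM : 3 ≤ M) (σ : Site3 K L M → S) : cubeEnergy (curry3 σ) ≤ energy (torus3 K L M) σ := by
  have hone : ∀ {n : ℕ}, 3 ≤ n → (1 : ZMod n) ≠ 0 ∧ (1 + 1 : ZMod n) ≠ 0 := by
    intro n hn
    have h1 := natCast_ne_zero_of_lt (n := n) (j := 1) one_pos (by omega)
    have h2 := natCast_ne_zero_of_lt (n := n) (j := 2) two_pos (by omega)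
    refine ⟨by simpa using h1, ?_⟩
    rw [one_add_one_eq_two]
    exact_mod_cast h2
  obtain ⟨k1, k2⟩ := hone hK
  obtain ⟨l1, l2⟩ := hone hL
  obtain ⟨m1, m2⟩ := hone hM
  set e : Fin 3 → Site3 K L M := ![((1, 0), 0), ((0, 1), 0), ((0, 0), 1)] with he
  refine le_trans (le_of_eq ?_) (sum_card_le_energy (torus3 K L M) e ?_ ?_ ?_ σ)
  · rw [cubeEnergy_eq, Fin.sum_univ_three]
    simp only [he, Matrix.cons_val_zero, Matrix.cons_val_one, Matrix.cons_val, changes_eq_sum,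
      curry3, Finset.card_filter, Fintype.sum_prod_type, Prod.mk_add_mk, add_zero]
    congr 2
    · rw [Finset.sum_comm (s := (univ : Finset (ZMod K)))]
      refine Finset.sum_congr rfl fun _ _ => ?_
      rw [Finset.sum_comm]
    · exact Finset.sum_congr rfl fun _ _ => Finset.sum_comm
  · intro d x
    fin_cases d
    · simp [he, torus3, torus2, SimpleGraph.boxProd_adj, torus1_adj_add_one (show 2 ≤ K by omega)]
    · simp [he, torus3, torus2, SimpleGraph.boxProd_adj, torus1_adj_add_one (show 2 ≤ L by omega)]
    · simp [he, torus3, torus2, SimpleGraph.boxProd_adj, torus1_adj_add_one (show 2 ≤ M by omega)]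
  · intro d d' h
    fin_cases d <;> fin_cases d' <;> simp_all [Prod.ext_iff]
  · intro d d'
    fin_cases d <;> fin_cases d' <;> simp_all [Prod.ext_iff]

end Energy

/-! ### Paths and intermediate volumes -/

section Paths

open Finset

variable {V S : Type*} [DecidableEq V]

theorem exists_isPath [Fintype V] (σ ζ : V → S) :
    ∃ (ω : ℕ → V → S) (T : ℕ), IsPath ω T ∧ ω 0 = σ ∧ ω T = ζ := by
  classical
  induction hn : #{x | σ x ≠ ζ x} generalizing σ with
  | zero =>
    refine ⟨fun _ => σ, 0, fun t ht => absurd ht (Nat.not_lt_zero t), rfl, ?_⟩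
    rw [Finset.card_eq_zero, Finset.filter_eq_empty_iff] at hn
    funext x
    exact not_not.1 (hn (Finset.mem_univ x))
  | succ n ih =>
    obtain ⟨x, hx⟩ : ({x | σ x ≠ ζ x} : Finset V).Nonempty := Finset.card_pos.1 (by omega)
    have hx' : σ x ≠ ζ x := (Finset.mem_filter.1 hx).2
    obtain ⟨ω, T, hω, h0, hT⟩ := ih (Function.update σ x (ζ x)) (by
      have : ({y | Function.update σ x (ζ x) y ≠ ζ y} : Finset V) =
          ({y | σ y ≠ ζ y} : Finset V).erase x := by
        ext y
        by_cases hy : y = x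
        · subst hy; simp
        · simp [hy]
      rw [this, Finset.card_erase_of_mem hx]
      omega)
    refine ⟨fun t => Nat.casesOn t σ ω, T + 1, ?_, rfl, hT⟩
    intro t ht
    cases t with
    | zero =>
      refine ⟨x, ζ x, h0, ?_⟩
      show ω 0 ≠ σ
      rw [h0]
      intro h
      exact hx' (by rw [← congrFun h x]; simp)
    | succ t => exact hω t (by omega)

/-- A discrete intermediate value theorem: only upward jumps need to be bounded. -/
theorem exists_eq_of_steps {n : ℕ → ℕ} {N : ℕ} (T : ℕ) (h0 : n 0 ≤ N) (hT : N ≤ n T)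
    (hstep : ∀ t < T, n (t + 1) ≤ n t + 1) : ∃ t ≤ T, n t = N := by
  induction T with
  | zero => exact ⟨0, le_rfl, le_antisymm h0 hT⟩
  | succ T ih =>
    rcases Nat.lt_or_ge (n T) N with h | h
    · have := hstep T (Nat.lt_succ_self T)
      exact ⟨T + 1, le_rfl, by omega⟩
    · obtain ⟨t, ht, hte⟩ := ih h (fun t ht => hstep t (by omega))
      exact ⟨t, by omega, hte⟩

open scoped Classical in
theorem Step.card_le [Fintype V] {σ ζ : V → S} (h : Step σ ζ) (B : Set S) :
    #{x | ζ x ∈ B} ≤ #{x | σ x ∈ B} + 1 ∧ #{x | σ x ∈ B} ≤ #{x | ζ x ∈ B} + 1 := by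
  obtain ⟨x, a, rfl, -⟩ := h
  constructor
  · refine (Finset.card_le_card (fun y hy => ?_)).trans (Finset.card_insert_le x _)
    simp only [Finset.mem_filter, Finset.mem_univ, true_and, Finset.mem_insert] at hy ⊢
    by_cases hyx : y = x
    · exact Or.inl hyx
    · right; simpa [hyx] using hy
  · refine (Finset.card_le_card (fun y hy => ?_)).trans (Finset.card_insert_le x _)
    simp only [Finset.mem_filter, Finset.mem_univ, true_and, Finset.mem_insert] at hy ⊢
    by_cases hyx : y = x
    · exact Or.inl hyx
    · right; simpa [hyx] using hy

open scoped Classical in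
/-- Along a path the number of spins in `B` takes all intermediate values. -/
theorem IsPath.exists_card_eq [Fintype V] {ω : ℕ → V → S} {T : ℕ} (hω : IsPath ω T) {A B : Set S}
    (hAB : A ∩ B = ∅) (hconn : Connects ω T (groundStates V A) (groundStates V B)) {N : ℕ}
    (hN : N ≤ Fintype.card V) : ∃ t ≤ T, #{x | ω t x ∈ B} = N := by
  have hA : ∀ σ ∈ groundStates V A, #{x | σ x ∈ B} = 0 := by
    rintro σ ⟨a, ha, rfl⟩
    have : a ∉ B := fun h => (Set.eq_empty_iff_forall_notMem.1 hAB) a ⟨ha, h⟩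
    simp [mono, this]
  have hB : ∀ σ ∈ groundStates V B, #{x | σ x ∈ B} = Fintype.card V := by
    rintro σ ⟨b, hb, rfl⟩
    simp [mono, hb]
  rcases hconn with ⟨h0, hT⟩ | ⟨h0, hT⟩
  · exact exists_eq_of_steps T (by rw [hA _ h0]; omega) (by rw [hB _ hT]; exact hN)
      (fun t ht => ((hω t ht).card_le B).1)
  -- A path starting in the `B` states is read backwards.
  · obtain ⟨t, ht, hte⟩ := exists_eq_of_steps (n := fun t => #{x | ω (T - t) x ∈ B}) (N := N) T
      (by simp only [Nat.sub_zero]; rw [hA _ hT]; omega)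
      (by simp only [Nat.sub_self]; rw [hB _ h0]; exact hN)
      (fun t ht => by
        have := ((hω (T - (t + 1)) (by omega)).card_le B).2
        rwa [show T - (t + 1) + 1 = T - t by omega] at this)
    exact ⟨T - t, by omega, hte⟩

end Paths

/-! ### The barrier along paths, and the proposition -/

section Main

open Finset
open scoped Classical

theorem cubeCount_curry3 {S : Type*} {K L M : ℕ} [NeZero K] [NeZero L] [NeZero M] (B : Set S)
    (σ : Site3 K L M → S) : cubeCount B (curry3 σ) = #{x | σ x ∈ B} := by
  unfold cubeCount curry3
  simp only [siteCount_eq_sum, Finset.card_filter, Fintype.sum_prod_type]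
  rw [Finset.sum_comm]
  exact Finset.sum_congr rfl fun _ _ => Finset.sum_comm

/-- Every path between the two classes of ground states reaches the barrier, and meets the gateway
if it does not exceed it. -/
theorem exists_barrier {S : Type*} {K L M : ℕ} (hK : 2829 ≤ K) (hKL : K ≤ L) (hLM : L ≤ M)
    {A B : Set S} (hAB : IsProperPartition A B) {T : ℕ} {ω : ℕ → Site3 K L M → S}
    (hω : IsPath ω T)
    (hconn : Connects ω T (groundStates (Site3 K L M) A) (groundStates (Site3 K L M) B)) :
    ∃ t ≤ T, Gamma K L ≤ energy (torus3 K L M) (ω t) ∧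
      (energy (torus3 K L M) (ω t) ≤ Gamma K L → ω t ∈ gatewayAB K L M A B) := by
  have : NeZero K := ⟨by omega⟩
  have : NeZero L := ⟨by omega⟩
  have : NeZero M := ⟨by omega⟩
  obtain ⟨r, hdK, hdL, hr1, hr2, hr3, hr4, hN1, hN2⟩ := exists_volume hK hKL hLM
  have hcard : Fintype.card (Site3 K L M) = K * L * M := by
    simp [Fintype.card_prod, ZMod.card]
  obtain ⟨t, ht, hcount⟩ := hω.exists_card_eq hAB.2.2.2 hconn
    (N := M / 2 * (K * L) + r) (by rw [hcard]; omega)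
  have hle := cubeEnergy_le_energy (by omega) (by omega) (by omega) (ω t)
  obtain ⟨h1, h2⟩ := gateway_of_cubeCount hK hKL hLM hdK hdL hr1 hr2 hr3 hr4 hN1 hN2
    ((cubeCount_curry3 B (ω t)).trans hcount)
  refine ⟨t, ht, h1.trans hle, fun hE => ?_⟩
  obtain ⟨a, b, ha, hb, hmem⟩ := h2 (hle.trans hE)
  exact ⟨a, (hAB.2.2.1.symm ▸ Set.mem_univ a : a ∈ A ∪ B).resolve_right ha, b, hb, hmem⟩

end Main

end Potts3D

theorem proposition8p1 (K L M q : ℕ) (hK : 2829 ≤ K) (hKL : K ≤ L) (hLM : L ≤ M) (hq : 2 ≤ q) :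
    (∀ s ∈ Potts3D.groundStates (Potts3D.Site3 K L M) (Set.univ : Set (Fin q)),
      ∀ s' ∈ Potts3D.groundStates (Potts3D.Site3 K L M) (Set.univ : Set (Fin q)), s ≠ s' →
        Potts3D.Gamma K L ≤ Potts3D.commHeight (Potts3D.torus3 K L M) s s') ∧
    (∀ A B : Set (Fin q), Potts3D.IsProperPartition A B →
      ∀ (T : ℕ) (ω : ℕ → Potts3D.Site3 K L M → Fin q), Potts3D.IsPath ω T →
        Potts3D.Connects ω T (Potts3D.groundStates (Potts3D.Site3 K L M) A)
          (Potts3D.groundStates (Potts3D.Site3 K L M) B) →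
        ((∀ t, t ≤ T → ω t ∉ Potts3D.gatewayAB K L M A B) →
          ∃ t, t ≤ T ∧ Potts3D.Gamma K L + 1 ≤ Potts3D.energy (Potts3D.torus3 K L M) (ω t)) ∧
        ((∀ t, t ≤ T → Potts3D.energy (Potts3D.torus3 K L M) (ω t) ≤ Potts3D.Gamma K L) →
          ∃ t, t ≤ T ∧ ω t ∈ Potts3D.gatewayAB K L M A B)) := by
  constructor
  · rintro s ⟨a, -, rfl⟩ s' ⟨b, -, rfl⟩ hne
    have : NeZero K := ⟨by omega⟩
    have : NeZero L := ⟨by omega⟩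
    have : NeZero M := ⟨by omega⟩
    have hab : a ≠ b := fun h => hne (h ▸ rfl)
    -- A path has to be exhibited, since the infimum of the empty set of naturals is 0.
    refine le_csInf ?_ ?_
    · obtain ⟨ω, T, hω, h0, hT⟩ := Potts3D.exists_isPath
        (Potts3D.mono (Potts3D.Site3 K L M) a) (Potts3D.mono (Potts3D.Site3 K L M) b)
      exact ⟨_, ω, T, hω, Or.inl ⟨h0, hT⟩, rfl⟩
    · rintro E ⟨ω, T, hω, hconn, rfl⟩
      -- Any partition separating `a` from `b` reduces the first claim to `exists_barrier`.
      have hpart : Potts3D.IsProperPartition {a} ({a}ᶜ : Set (Fin q)) :=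
        ⟨⟨a, rfl⟩, ⟨b, fun h => hab h.symm⟩, Set.union_compl_self _, Set.inter_compl_self _⟩
      have hA : Potts3D.mono (Potts3D.Site3 K L M) a ∈
          Potts3D.groundStates (Potts3D.Site3 K L M) {a} := ⟨a, rfl, rfl⟩
      have hB : Potts3D.mono (Potts3D.Site3 K L M) b ∈
          Potts3D.groundStates (Potts3D.Site3 K L M) ({a}ᶜ : Set (Fin q)) :=
        ⟨b, fun h => hab h.symm, rfl⟩
      obtain ⟨t, ht, hge, -⟩ := Potts3D.exists_barrier hK hKL hLM hpart hω (by
        rcases hconn with ⟨h0, hT⟩ | ⟨h0, hT⟩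
        · exact Or.inl ⟨h0 ▸ hA, hT ▸ hB⟩
        · exact Or.inr ⟨h0 ▸ hB, hT ▸ hA⟩)
      exact hge.trans (Finset.le_sup
        (f := fun t => Potts3D.energy (Potts3D.torus3 K L M) (ω t))
        (Finset.mem_range.2 (Nat.lt_succ_of_le ht)))
  · intro A B hAB T ω hω hconn
    obtain ⟨t, ht, -, hgate⟩ := Potts3D.exists_barrier hK hKL hLM hAB hω hconn
    constructor
    · intro hnot
      exact ⟨t, ht, Nat.succ_le_of_lt (not_le.1 fun h => hnot t ht (hgate h))⟩
    · intro hle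
      exact ⟨t, ht, hgate (hle t ht)⟩
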